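/- All manifolds are smooth, finite-dimensional, Hausdorff, second countable and without boundary. Let $p\colon M\to B$ be a smooth submersion with connected (in particular non-empty) fibres, let $\mathrm{Ver}=\ker dp\subset TM$ be the vertical bundle, and let $\omega_V\in\Omega^2(\mathrm{Ver})$ be a smooth vertical $2$-form that is vertically closed, $d_V\omega_V=0$, and non-degenerate on every vertical space, i.e. a smoothly varying family of symplectic forms on the fibres. For an Ehresmann connection $TM=\mathrm{Ver}\oplus\mathrm{Hor}$ let $h(u)$ be the horizontal lift of a vector field $u\in\mathfrak X(B)$ and let $$C(u,v)=[h(u),h(v)]-h([u,v])$$ be its curvature, which takes values in vertical vector fields. The connection is called *symplectic* if $\mathcal L_{h(u)}\omega_V=0$ in $\Omega^2(\mathrm{Ver})$ for all $u\in\mathfrak X(B)$, and it is said to have *hamiltonian curvature* if there is a $2$-form $\omega_H\in\Omega^2(B,C^\infty(M))$ on $B$ with values in the functions on $M$ (a smooth section over $M$ of $p^*\Lambda^2T^*B$) such that $i_{C(u,v)}\omega_V=-d_V\bigl(\omega_H(u,v)\bigr)$ for all $u,v\in\mathfrak X(B)$. A form $\omega\in\Omega^2(M)$ *extends* $\omega_V$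 if its restriction to $\mathrm{Ver}$ is $\omega_V$. Assume that $(M\xrightarrow{p}B,\omega_V)$ admits a symplectic connection with hamiltonian curvature (completeness of the connection is not required). Then: 1. there are a $2$-form $\omega\in\Omega^2(M)$ extending $\omega_V$ and a closed $3$-form $\phi\in\Omega^3(B)$ such that $d\omega=p^*\phi$; 2. for every such pair $(\omega,\phi)$, if the class $[\phi]\in H^3(B)$ vanishes (that is, $\phi=d\psi$ for some $\psi\in\Omega^2(B)$), then $\omega_V$ admits a closed extension, i.e. there is $\omega'\in\Omega^2(M)$ extending $\omega_V$ with $d\omega'=0$. -/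

import Mathlib

open scoped Manifold ContDiff Topology
open VectorField

section
variable {E F M B : Type*} [NormedAddCommGroup E] [NormedSpace ℝ E]
  [NormedAddCommGroup F] [NormedSpace ℝ F]
  [TopologicalSpace M] [ChartedSpace E M] [TopologicalSpace B] [ChartedSpace F B]

theorem two_le_smooth : (2 : WithTop ℕ∞) ≤ ∞ := by
  exact WithTop.coe_le_coe.2 (le_top : (2 : ℕ∞) ≤ ⊤)

/-- If the vector fields `V`, `W` on `E` are `f`-related to `v`, `w`, then `[V, W]` is `f`-related
to `[v, w]`. -/
theorem lieBracket_related {f : E → F} {V W : E → E} {v w : F → F} {y : E}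
    (hf : ContDiffAt ℝ 2 f y)
    (hV : DifferentiableAt ℝ V y) (hW : DifferentiableAt ℝ W y)
    (hv : DifferentiableAt ℝ v (f y)) (hw : DifferentiableAt ℝ w (f y))
    (hVv : ∀ᶠ z in 𝓝 y, fderiv ℝ f z (V z) = v (f z))
    (hWw : ∀ᶠ z in 𝓝 y, fderiv ℝ f z (W z) = w (f z)) :
    fderiv ℝ f y (lieBracket ℝ V W y) = lieBracket ℝ v w (f y) := by
  have hfd : DifferentiableAt ℝ f y := hf.differentiableAt (by norm_num)
  have hf' : DifferentiableAt ℝ (fderiv ℝ f) y :=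
    (hf.fderiv_right (m := 1) (by norm_num)).differentiableAt (by norm_num)
  have key : ∀ {X : E → E} {x : F → F}, DifferentiableAt ℝ X y → DifferentiableAt ℝ x (f y) →
      (∀ᶠ z in 𝓝 y, fderiv ℝ f z (X z) = x (f z)) → ∀ a,
      fderiv ℝ (fderiv ℝ f) y a (X y) + fderiv ℝ f y (fderiv ℝ X y a)
        = fderiv ℝ x (f y) (fderiv ℝ f y a) := by
    intro X x hX hx h a
    have h1 := Filter.EventuallyEq.fderiv_eq (𝕜 := ℝ) h
    have h2 := fderiv_clm_apply hf' hX
    have h3 : fderiv ℝ (fun z => x (f z)) y = (fderiv ℝ x (f y)).comp (fderiv ℝ f y) :=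
      fderiv_comp y hx hfd
    rw [h3, h2] at h1
    have := congrArg (fun L => L a) h1
    simp at this
    rw [← this]; abel
  have sym : IsSymmSndFDerivAt ℝ f y := hf.isSymmSndFDerivAt (by simp)
  have k1 := key hV hv hVv (W y)
  have k2 := key hW hw hWw (V y)
  have s := sym (V y) (W y)
  rw [hWw.self_of_nhds] at k1
  rw [hVv.self_of_nhds] at k2
  simp only [lieBracket_eq, map_sub]
  rw [← k1, ← k2, s]; abel

/-- If the vector fields `V`, `W` on `M` are `p`-related to `v`, `w`, then `[V, W]` is `p`-related
to `[v, w]`. -/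
theorem mlieBracket_related [CompleteSpace E] [CompleteSpace F]
    [IsManifold 𝓘(ℝ, E) ∞ M] [IsManifold 𝓘(ℝ, F) ∞ B] {p : M → B}
    (hp : ContMDiff 𝓘(ℝ, E) 𝓘(ℝ, F) ∞ p)
    {V W : Π x : M, TangentSpace 𝓘(ℝ, E) x} {v w : Π b : B, TangentSpace 𝓘(ℝ, F) b}
    (hV : CMDiff ∞ (T% V)) (hW : CMDiff ∞ (T% W)) (hv : CMDiff ∞ (T% v)) (hw : CMDiff ∞ (T% w))
    (hVv : ∀ x, mfderiv 𝓘(ℝ, E) 𝓘(ℝ, F) p x (V x) = v (p x))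
    (hWw : ∀ x, mfderiv 𝓘(ℝ, E) 𝓘(ℝ, F) p x (W x) = w (p x)) (x : M) :
    mfderiv 𝓘(ℝ, E) 𝓘(ℝ, F) p x (mlieBracket 𝓘(ℝ, E) V W x)
      = mlieBracket 𝓘(ℝ, F) v w (p x) := by
  have : IsManifold 𝓘(ℝ, E) 2 M := IsManifold.of_le (n := ∞) two_le_smooth
  have : IsManifold 𝓘(ℝ, F) 2 B := IsManifold.of_le (n := ∞) two_le_smooth
  have : IsManifold 𝓘(ℝ, E) 1 M := IsManifold.of_le (n := ∞) (by exact_mod_cast le_top)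
  have : IsManifold 𝓘(ℝ, F) 1 B := IsManifold.of_le (n := ∞) (by exact_mod_cast le_top)
  set φ := extChartAt 𝓘(ℝ, E) x with hφ
  set ψ := extChartAt 𝓘(ℝ, F) (p x) with hψ
  set f : E → F := ψ ∘ p ∘ φ.symm with hf
  -- local expressions of the fields
  let hatM : (Π x : M, TangentSpace 𝓘(ℝ, E) x) → E → E := fun X =>
    mpullbackWithin 𝓘(ℝ, E) 𝓘(ℝ, E) φ.symm X (Set.range 𝓘(ℝ, E))
  let hatB : (Π x : B, TangentSpace 𝓘(ℝ, F) x) → F → F := fun X =>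
    mpullbackWithin 𝓘(ℝ, F) 𝓘(ℝ, F) ψ.symm X (Set.range 𝓘(ℝ, F))
  have hfx : f (φ x) = ψ (p x) := by simp [hf, hφ]
  have hsrc : ∀ᶠ z in 𝓝 x, z ∈ φ.source := extChartAt_source_mem_nhds x
  have hsrcB : ∀ᶠ z in 𝓝 x, p z ∈ ψ.source :=
    hp.continuous.continuousAt.preimage_mem_nhds (extChartAt_source_mem_nhds (p x))
  have hatM_spec : ∀ X : (Π x : M, TangentSpace 𝓘(ℝ, E) x), ∀ᶠ z in 𝓝 x,
      mfderiv 𝓘(ℝ, E) 𝓘(ℝ, E) φ z (X z) = hatM X (φ z) := by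
    intro X
    have := eventuallyEq_mpullback_mpullbackWithin_extChartAt (I := 𝓘(ℝ, E)) (s := Set.univ)
      (x := x) X
    rw [nhdsWithin_univ] at this
    filter_upwards [this, hsrc] with z hz hz'
    rw [hz, mpullback_apply]
    exact (isInvertible_mfderiv_extChartAt hz').self_apply_inverse _
  have hatB_spec : ∀ X : (Π x : B, TangentSpace 𝓘(ℝ, F) x), ∀ᶠ z in 𝓝 (p x),
      mfderiv 𝓘(ℝ, F) 𝓘(ℝ, F) ψ z (X z) = hatB X (ψ z) := by
    intro X
    have := eventuallyEq_mpullback_mpullbackWithin_extChartAt (I := 𝓘(ℝ, F)) (s := Set.univ)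
      (x := p x) X
    rw [nhdsWithin_univ] at this
    filter_upwards [this, extChartAt_source_mem_nhds (I := 𝓘(ℝ, F)) (p x)] with z hz hz'
    rw [hz, mpullback_apply]
    exact (isInvertible_mfderiv_extChartAt hz').self_apply_inverse _
  have hpd : ∀ z, MDifferentiableAt 𝓘(ℝ, E) 𝓘(ℝ, F) p z := fun z =>
    (hp z).mdifferentiableAt (by simp)
  have hfC : ContDiffAt ℝ 2 f (φ x) := by
    have h0 : ContMDiffAt 𝓘(ℝ, E) 𝓘(ℝ, F) ∞ p x := hp x
    have h := (contMDiffAt_iff.1 h0).2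
    rw [modelWithCornersSelf_coe, Set.range_id, contDiffWithinAt_univ] at h
    exact h.of_le two_le_smooth
  have sM : (φ.symm ⁻¹' Set.univ ∩ Set.range 𝓘(ℝ, E)) = Set.univ := by simp
  have sB : (ψ.symm ⁻¹' Set.univ ∩ Set.range 𝓘(ℝ, F)) = Set.univ := by simp
  have hfd : ∀ᶠ z in 𝓝 x, DifferentiableAt ℝ f (φ z) := by
    have h1 : ∀ᶠ y in 𝓝 (φ x), DifferentiableAt ℝ f y :=
      (hfC.eventually (by simp)).mono fun y hy => hy.differentiableAt (by norm_num)
    exact (continuousAt_extChartAt x).eventually h1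
  -- the chain rule for `f ∘ φ = ψ ∘ p`
  have chain : ∀ᶠ z in 𝓝 x, ∀ a : TangentSpace 𝓘(ℝ, E) z,
      fderiv ℝ f (φ z) (mfderiv 𝓘(ℝ, E) 𝓘(ℝ, E) φ z a)
        = mfderiv 𝓘(ℝ, F) 𝓘(ℝ, F) ψ (p z) (mfderiv 𝓘(ℝ, E) 𝓘(ℝ, F) p z a) := by
    have heq : ∀ᶠ z in 𝓝 x, (f ∘ φ) z = (ψ ∘ p) z := by
      filter_upwards [hsrc] with z hz
      simp [hf, φ.left_inv hz]
    filter_upwards [heq.eventually_nhds, hsrc, hsrcB, hfd] with z hz hz1 hz2 hz3 a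
    have hz1' : z ∈ (chartAt E x).source := by simpa [hφ] using hz1
    have hz2' : p z ∈ (chartAt F (p x)).source := by simpa [hψ] using hz2
    have e1 : mfderiv 𝓘(ℝ, E) 𝓘(ℝ, F) (f ∘ φ) z
        = (mfderiv 𝓘(ℝ, E) 𝓘(ℝ, F) f (φ z)).comp (mfderiv 𝓘(ℝ, E) 𝓘(ℝ, E) φ z) :=
      mfderiv_comp z hz3.mdifferentiableAt (mdifferentiableAt_extChartAt hz1')
    have e2 : mfderiv 𝓘(ℝ, E) 𝓘(ℝ, F) (ψ ∘ p) z
        = (mfderiv 𝓘(ℝ, F) 𝓘(ℝ, F) ψ (p z)).comp (mfderiv 𝓘(ℝ, E) 𝓘(ℝ, F) p z) :=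
      mfderiv_comp z (mdifferentiableAt_extChartAt hz2') (hpd z)
    have e3 : mfderiv 𝓘(ℝ, E) 𝓘(ℝ, F) (f ∘ φ) z = mfderiv 𝓘(ℝ, E) 𝓘(ℝ, F) (ψ ∘ p) z :=
      Filter.EventuallyEq.mfderiv_eq hz
    rw [mfderiv_eq_fderiv] at e1
    have e4 := congrArg (fun L => L a) (e1.symm.trans ((show _ = _ from e3).trans e2))
    exact e4
  -- the local expressions are related by `f`
  have hrel : ∀ (X : Π x : M, TangentSpace 𝓘(ℝ, E) x) (u : Π b : B, TangentSpace 𝓘(ℝ, F) b),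
      (∀ x, mfderiv 𝓘(ℝ, E) 𝓘(ℝ, F) p x (X x) = u (p x)) →
      ∀ᶠ y in 𝓝 (φ x), fderiv ℝ f y (hatM X y) = hatB u (f y) := by
    intro X u hXu
    have h0 : ∀ᶠ z in 𝓝 x, fderiv ℝ f (φ z) (hatM X (φ z)) = hatB u (f (φ z)) := by
      filter_upwards [hatM_spec X, hp.continuous.continuousAt.eventually (hatB_spec u), chain,
        hsrc] with z h1 h2 h3 h4
      rw [← h1, h3, hXu]
      have h5 : f (φ z) = ψ (p z) := by simp [hf, φ.left_inv h4]
      rw [h5]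
      exact h2
    have hc : Filter.Tendsto φ.symm (𝓝 (φ x)) (𝓝 x) := by
      have := continuousAt_extChartAt_symm (I := 𝓘(ℝ, E)) x
      rw [ContinuousAt, extChartAt_to_inv] at this
      exact this
    filter_upwards [hc.eventually h0, extChartAt_target_mem_nhds (I := 𝓘(ℝ, E)) x] with y h1 h2
    rwa [φ.right_inv h2] at h1
  have hdM : ∀ X : (Π x : M, TangentSpace 𝓘(ℝ, E) x), CMDiff ∞ (T% X) →
      DifferentiableAt ℝ (hatM X) (φ x) := by
    intro X hX
    have := ((hX x).mdifferentiableAt (by simp)).mdifferentiableWithinAt (s := Set.univ)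
      |>.differentiableWithinAt_mpullbackWithin_vectorField
    rw [sM] at this
    exact (differentiableWithinAt_univ (f := hatM X)).1 this
  have hdB : ∀ X : (Π x : B, TangentSpace 𝓘(ℝ, F) x), CMDiff ∞ (T% X) →
      DifferentiableAt ℝ (hatB X) (f (φ x)) := by
    intro X hX
    have := ((hX (p x)).mdifferentiableAt (by simp)).mdifferentiableWithinAt (s := Set.univ)
      |>.differentiableWithinAt_mpullbackWithin_vectorField
    rw [hfx]
    rw [sB] at this
    exact (differentiableWithinAt_univ (f := hatB X)).1 this
  have main := lieBracket_related hfC (hdM V hV) (hdM W hW) (hdB v hv) (hdB w hw)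
    (hrel V v hVv) (hrel W w hWw)
  have iφ := isInvertible_mfderiv_extChartAt (I := 𝓘(ℝ, E)) (mem_extChartAt_source (I := 𝓘(ℝ, E)) x)
  have iψ := isInvertible_mfderiv_extChartAt (I := 𝓘(ℝ, F))
    (mem_extChartAt_source (I := 𝓘(ℝ, F)) (p x))
  have bM : mfderiv 𝓘(ℝ, E) 𝓘(ℝ, E) φ x (mlieBracket 𝓘(ℝ, E) V W x)
      = lieBracket ℝ (hatM V) (hatM W) (φ x) := by
    rw [← mlieBracketWithin_univ, mlieBracketWithin_apply]
    refine (iφ.self_apply_inverse _).trans ?_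
    rw [sM]
    exact congrFun (lieBracketWithin_univ (V := hatM V) (W := hatM W)) _
  have bB : mfderiv 𝓘(ℝ, F) 𝓘(ℝ, F) ψ (p x) (mlieBracket 𝓘(ℝ, F) v w (p x))
      = lieBracket ℝ (hatB v) (hatB w) (f (φ x)) := by
    rw [← mlieBracketWithin_univ, mlieBracketWithin_apply, hfx]
    refine (iψ.self_apply_inverse _).trans ?_
    rw [sB]
    exact congrFun (lieBracketWithin_univ (V := hatB v) (W := hatB w)) _
  apply iψ.injective
  exact ((chain.self_of_nhds _).symm.trans (congrArg _ bM)).trans (main.trans bB.symm)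
end

noncomputable section FibrationDefs

variable {E F M B : Type*} [NormedAddCommGroup E] [NormedSpace ℝ E]
  [NormedAddCommGroup F] [NormedSpace ℝ F]
  [TopologicalSpace M] [ChartedSpace E M] [TopologicalSpace B] [ChartedSpace F B]

/-! ### Differential forms on a manifold -/

/-- The expression of a field of alternating `k`-linear forms in the chart around `x₀`, i.e. its
pullback under the inverse of the chart. -/
def chartExpr {k : ℕ} (α : ∀ x : M, TangentSpace 𝓘(ℝ, E) x [⋀^Fin k]→L[ℝ] ℝ) (x₀ : M) (y : E) :
    E [⋀^Fin k]→L[ℝ] ℝ :=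
  (α ((extChartAt 𝓘(ℝ, E) x₀).symm y)).compContinuousLinearMap
    (mfderiv 𝓘(ℝ, E) 𝓘(ℝ, E) (extChartAt 𝓘(ℝ, E) x₀).symm y)

/-- Smooth differential `k`-forms on the manifold `M` modelled on `E`. -/
structure DiffForm (E M : Type*) [NormedAddCommGroup E] [NormedSpace ℝ E]
    [TopologicalSpace M] [ChartedSpace E M] (k : ℕ) where
  toFun : ∀ x : M, TangentSpace 𝓘(ℝ, E) x [⋀^Fin k]→L[ℝ] ℝ
  smooth : ∀ x₀ : M, ContDiffOn ℝ ∞ (chartExpr toFun x₀) (extChartAt 𝓘(ℝ, E) x₀).target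

namespace DiffForm

instance {k : ℕ} : CoeFun (DiffForm E M k)
    (fun _ => ∀ x : M, TangentSpace 𝓘(ℝ, E) x [⋀^Fin k]→L[ℝ] ℝ) := ⟨DiffForm.toFun⟩

/-- The exterior derivative, computed at `x` in the chart around `x`. -/
def d {k : ℕ} (α : DiffForm E M k) (x : M) : TangentSpace 𝓘(ℝ, E) x [⋀^Fin (k + 1)]→L[ℝ] ℝ :=
  (extDeriv (chartExpr α x) (extChartAt 𝓘(ℝ, E) x x)).compContinuousLinearMap
    (mfderiv 𝓘(ℝ, E) 𝓘(ℝ, E) (extChartAt 𝓘(ℝ, E) x) x)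

/-- The form is closed. -/
def Closed {k : ℕ} (α : DiffForm E M k) : Prop := ∀ x, α.d x = 0

/-- The form is exact. For a closed form this says that its de Rham class vanishes. -/
def Exact {k : ℕ} (α : DiffForm E M (k + 1)) : Prop :=
  ∃ ψ : DiffForm E M k, ∀ x, α x = ψ.d x

/-- The value at `x` of the pullback of a form on `B` under `p : M → B`. -/
def pullbackAt {k : ℕ} (p : M → B) (φ : DiffForm F B k) (x : M) :
    TangentSpace 𝓘(ℝ, E) x [⋀^Fin k]→L[ℝ] ℝ :=
  (φ (p x)).compContinuousLinearMap (mfderiv 𝓘(ℝ, E) 𝓘(ℝ, F) p x)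

end DiffForm

/-! ### Vector fields -/

/-- Smooth vector fields on the manifold `M` modelled on `E`. -/
abbrev VField (E M : Type*) [NormedAddCommGroup E] [NormedSpace ℝ E]
    [TopologicalSpace M] [ChartedSpace E M] [IsManifold 𝓘(ℝ, E) ∞ M] : Type _ :=
  ContMDiffSection 𝓘(ℝ, E) E ∞ (TangentSpace 𝓘(ℝ, E) : M → Type _)

variable [IsManifold 𝓘(ℝ, E) ∞ M] [IsManifold 𝓘(ℝ, F) ∞ B]

namespace VField

/-- The derivative of a function along a vector field. -/
def deriv (X : VField E M) (f : M → ℝ) (x : M) : ℝ := mfderiv 𝓘(ℝ, E) 𝓘(ℝ, ℝ) f x (X x)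

/-- The Lie bracket of smooth vector fields. -/
def bracket [FiniteDimensional ℝ E] (X Y : VField E M) : VField E M where
  toFun := mlieBracket 𝓘(ℝ, E) X Y
  contMDiff_toFun := by
    have : CompleteSpace E := FiniteDimensional.complete ℝ E
    have : IsManifold 𝓘(ℝ, E) (((⊤ : ℕ∞) : WithTop ℕ∞) + 1) M :=
      inferInstanceAs (IsManifold 𝓘(ℝ, E) ∞ M)
    have : IsManifold 𝓘(ℝ, E) (minSmoothness ℝ 2) M :=
      IsManifold.of_le (n := ∞) (by simpa using two_le_smooth)
    exact ContDiff.mlieBracket_vectorField (m := ⊤) (n := ⊤) X.contMDiff Y.contMDiff (by simp)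

end VField

/-! ### The vertical bundle -/

variable (E F)

/-- The vertical space `Ver_x = ker (d_x p)`. -/
abbrev Ver (p : M → B) (x : M) : Submodule ℝ (TangentSpace 𝓘(ℝ, E) x) :=
  LinearMap.ker (mfderiv 𝓘(ℝ, E) 𝓘(ℝ, F) p x).toLinearMap

/-- Smooth vertical vector fields, i.e. smooth sections of `Ver`. -/
def VerField (p : M → B) : Type _ := {X : VField E M // ∀ x, X x ∈ Ver E F p x}

variable {E F}

namespace VerField

variable {p : M → B}

/-- The value of a vertical vector field, as a vertical vector. -/
def at' (X : VerField E F p) (x : M) : Ver E F p x := ⟨X.1 x, X.2 x⟩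

/-- The Lie bracket of vertical vector fields. -/
def bracket [FiniteDimensional ℝ E] [FiniteDimensional ℝ F] (hp : ContMDiff 𝓘(ℝ, E) 𝓘(ℝ, F) ∞ p)
    (X Y : VerField E F p) : VerField E F p :=
  ⟨X.1.bracket Y.1, fun x => by
    have : CompleteSpace E := FiniteDimensional.complete ℝ E
    have : CompleteSpace F := FiniteDimensional.complete ℝ F
    have h := mlieBracket_related hp X.1.contMDiff Y.1.contMDiff
      (0 : VField F B).contMDiff (0 : VField F B).contMDiff X.2 Y.2 x
    refine LinearMap.mem_ker.2 (h.trans ?_)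
    exact congrFun (mlieBracket_self (I := 𝓘(ℝ, F)) (V := ((0 : VField F B) : ∀ b, TangentSpace 𝓘(ℝ, F) b))) (p x)⟩

end VerField

variable (E F)

/-- Smooth vertical `2`-forms, i.e. elements of `Ω²(Ver)`: a `2`-form on every vertical space,
depending smoothly on the point. -/
structure VerTwoForm (p : M → B) where
  toFun : ∀ x : M, Ver E F p x [⋀^Fin 2]→L[ℝ] ℝ
  smooth : ∀ X Y : VerField E F p,
    ContMDiff 𝓘(ℝ, E) 𝓘(ℝ, ℝ) ∞ (fun x => toFun x ![X.at' x, Y.at' x])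

/-- `2`-forms on `B` with values in the smooth functions on `M`, i.e. elements of
`Ω²(B, C^∞(M))`: smooth sections over `M` of the pullback bundle `p^*(Λ²T^*B)`. -/
structure HorTwoForm (p : M → B) where
  toFun : ∀ x : M, TangentSpace 𝓘(ℝ, F) (p x) [⋀^Fin 2]→L[ℝ] ℝ
  smooth : ∀ u v : VField F B,
    ContMDiff 𝓘(ℝ, E) 𝓘(ℝ, ℝ) ∞ (fun x => toFun x ![u (p x), v (p x)])

variable {E F}

/-- The smooth function `β(u, v)` on `M`, for vector fields `u`, `v` on `B`. -/
def HorTwoForm.eval {p : M → B} (β : HorTwoForm E F p) (u v : VField F B) (x : M) : ℝ :=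
  β.toFun x ![u (p x), v (p x)]

namespace VerTwoForm

variable {p : M → B}

/-- The function `η(X, Y)`, for vertical vector fields `X`, `Y`. -/
def eval (η : VerTwoForm E F p) (X Y : VerField E F p) (x : M) : ℝ :=
  η.toFun x ![X.at' x, Y.at' x]

/-- The vertical de Rham differential `d_V η`, evaluated on vertical vector fields. -/
def dVer [FiniteDimensional ℝ E] [FiniteDimensional ℝ F] (hp : ContMDiff 𝓘(ℝ, E) 𝓘(ℝ, F) ∞ p)
    (η : VerTwoForm E F p) (X Y Z : VerField E F p) (x : M) : ℝ :=
  X.1.deriv (η.eval Y Z) x - Y.1.deriv (η.eval X Z) x + Z.1.deriv (η.eval X Y) x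
    - η.eval (X.bracket hp Y) Z x + η.eval (X.bracket hp Z) Y x - η.eval (Y.bracket hp Z) X x

/-- `η` is a smoothly varying family of symplectic forms on the fibres: it is vertically closed
and non-degenerate on every vertical space. -/
structure FibrewiseSymplectic [FiniteDimensional ℝ E] [FiniteDimensional ℝ F]
    (hp : ContMDiff 𝓘(ℝ, E) 𝓘(ℝ, F) ∞ p) (η : VerTwoForm E F p) : Prop where
  closed : ∀ (X Y Z : VerField E F p) (x : M), η.dVer hp X Y Z x = 0
  nondegenerate : ∀ (x : M) (v : Ver E F p x), (∀ w, η.toFun x ![v, w] = 0) → v = 0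

/-- The `2`-form `α` on `M` extends `η`, i.e. restricts to `η` on the vertical spaces. -/
def IsExtendedBy (η : VerTwoForm E F p) (α : DiffForm E M 2) : Prop :=
  ∀ (x : M) (v w : Ver E F p x), α x ![(v : TangentSpace 𝓘(ℝ, E) x), w] = η.toFun x ![v, w]

end VerTwoForm

/-! ### Connections -/

variable (E F)

/-- An Ehresmann connection on `p : M → B`, given by its horizontal lift: a smooth right inverse
of `dp : TM → p^*TB`. Such a right inverse is the same as a smooth splitting `TM = Ver ⊕ Hor`, see
`EhresmannConnection.Hor` and `EhresmannConnection.isCompl`. -/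
structure EhresmannConnection (p : M → B) where
  lift : ∀ x : M, TangentSpace 𝓘(ℝ, F) (p x) →L[ℝ] TangentSpace 𝓘(ℝ, E) x
  mfderiv_lift : ∀ (x : M) (u : TangentSpace 𝓘(ℝ, F) (p x)),
    mfderiv 𝓘(ℝ, E) 𝓘(ℝ, F) p x (lift x u) = u
  smooth : ∀ u : VField F B, CMDiff ∞ (T% (fun x => lift x (u (p x))))

variable {E F}

namespace EhresmannConnection

variable {p : M → B} (H : EhresmannConnection E F p)

/-- The horizontal space at `x`. -/
def Hor (x : M) : Submodule ℝ (TangentSpace 𝓘(ℝ, E) x) :=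
  LinearMap.range (H.lift x).toLinearMap

theorem isCompl (x : M) : IsCompl (Ver E F p x) (H.Hor x) := by
  constructor
  · rw [Submodule.disjoint_def]
    rintro _ hv ⟨u, rfl⟩
    have h1 : mfderiv 𝓘(ℝ, E) 𝓘(ℝ, F) p x (H.lift x u) = 0 := hv
    rw [H.mfderiv_lift] at h1
    simp [h1]
  · rw [codisjoint_iff, eq_top_iff]
    intro v _
    rw [Submodule.mem_sup]
    refine ⟨v - H.lift x (mfderiv 𝓘(ℝ, E) 𝓘(ℝ, F) p x v), ?_,
      H.lift x (mfderiv 𝓘(ℝ, E) 𝓘(ℝ, F) p x v), ⟨_, rfl⟩, by simp⟩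
    refine LinearMap.mem_ker.2 ?_
    change mfderiv 𝓘(ℝ, E) 𝓘(ℝ, F) p x (v - H.lift x (mfderiv 𝓘(ℝ, E) 𝓘(ℝ, F) p x v)) = 0
    rw [map_sub, H.mfderiv_lift, sub_self]

/-- The horizontal lift `h(u)` of a vector field `u` on `B`. -/
def liftField (u : VField F B) : VField E M := ⟨fun x => H.lift x (u (p x)), H.smooth u⟩

variable [FiniteDimensional ℝ E] [FiniteDimensional ℝ F] (hp : ContMDiff 𝓘(ℝ, E) 𝓘(ℝ, F) ∞ p)

/-- The bracket `[h(u), X]` with a vertical vector field `X`, which is again vertical. -/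
def liftBracket (u : VField F B) (X : VerField E F p) : VerField E F p :=
  ⟨(H.liftField u).bracket X.1, fun x => by
    have : CompleteSpace E := FiniteDimensional.complete ℝ E
    have : CompleteSpace F := FiniteDimensional.complete ℝ F
    have h := mlieBracket_related hp (H.liftField u).contMDiff X.1.contMDiff
      u.contMDiff (0 : VField F B).contMDiff (fun x => H.mfderiv_lift x _) X.2 x
    refine LinearMap.mem_ker.2 (h.trans ?_)
    exact congrFun (mlieBracket_zero_right (I := 𝓘(ℝ, F)) (W := ⇑u)) (p x)⟩

/-- The curvature `C(u, v) = [h(u), h(v)] - h([u, v])`, a vertical vector field. -/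
def curvature (u v : VField F B) : VerField E F p :=
  ⟨(H.liftField u).bracket (H.liftField v) - H.liftField (u.bracket v), fun x => by
    have : CompleteSpace E := FiniteDimensional.complete ℝ E
    have : CompleteSpace F := FiniteDimensional.complete ℝ F
    have h := mlieBracket_related hp (H.liftField u).contMDiff (H.liftField v).contMDiff
      u.contMDiff v.contMDiff (fun x => H.mfderiv_lift x _) (fun x => H.mfderiv_lift x _) x
    have h' := H.mfderiv_lift x (u.bracket v (p x))
    refine LinearMap.mem_ker.2 ?_
    exact (map_sub (mfderiv 𝓘(ℝ, E) 𝓘(ℝ, F) p x) _ _).trans (sub_eq_zero.2 (h.trans h'.symm))⟩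

/-- The Lie derivative `L_{h(u)} η = (d_H η)(u)`, evaluated on vertical vector fields. -/
def lieDeriv (η : VerTwoForm E F p) (u : VField F B) (X Y : VerField E F p) (x : M) : ℝ :=
  (H.liftField u).deriv (η.eval X Y) x
    - η.eval (H.liftBracket hp u X) Y x - η.eval X (H.liftBracket hp u Y) x

/-- The connection is symplectic: `d_H η = 0`, i.e. its parallel transport preserves `η`. -/
def IsSymplectic (η : VerTwoForm E F p) : Prop :=
  ∀ (u : VField F B) (X Y : VerField E F p) (x : M), H.lieDeriv hp η u X Y x = 0

/-- The connection has hamiltonian curvature with respect to `η`: there is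
`β ∈ Ω²(B, C^∞(M))` such that `i_{C(u, v)} η = - d_V (β(u, v))` for all vector fields
`u`, `v` on `B`. -/
def HasHamiltonianCurvature (η : VerTwoForm E F p) : Prop :=
  ∃ β : HorTwoForm E F p, ∀ (u v : VField F B) (X : VerField E F p) (x : M),
    η.eval (H.curvature hp u v) X x = - X.1.deriv (β.eval u v) x

end EhresmannConnection

end FibrationDefs

/-!
Let `H` be a symplectic connection and `β` a form with `i_C η = - d_V β`, where `η` is the vertical
form and `C` the curvature. The coupling form `Ω` is `η` on `Ver`, `-β` on `Hor`, and makes these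
two orthogonal. The components of `dΩ` with at least one vertical argument are

* `d_V η` on three vertical vectors, zero as `η` is vertically closed,
* `L_{h(u)} η` on two vertical vectors, zero as `H` is symplectic,
* `-(i_C η + d_V β)` on one vertical vector, zero by the choice of `β`

(`couplingForm_d_eq_zero_of_ver`). So `T = dΩ` is a closed form vanishing on vertical vectors. In
charts in which `p` is a linear projection, closedness says that the derivative of `T` in vertical
directions is zero, so `T` is locally constant along the fibres; these are connected, so it descends
to a form `φ` on the base with `T = p^* φ` (`DiffForm.exists_eq_pullback`). Local sections of `p`
show that `φ` is smooth, and `φ` is closed because `p^* dφ = dT = 0` and `dp` is surjective. If `φ =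
dψ`, then `Ω - p^* ψ` is closed, and it has the same restriction to `Ver` as `Ω`.

A form is handled through its pullbacks `pull` under smooth maps from normed spaces, of which the
expressions in charts, in the normal form of `p` and along local sections are instances. The
exterior derivative, defined at each point by the chart around that point, commutes with all of them
(`DiffForm.extDeriv_pull`). The components of `dΩ` come from the invariant formula
`DiffForm.d_apply_vField` for global vector fields, which exist through every tangent vector because
germs extend by means of bump functions.
-/

/-! ### Fields of alternating forms on normed spaces -/

section Linear

variable {N E G : Type*} [NormedAddCommGroup N] [NormedSpace ℝ N]
  [NormedAddCommGroup E] [NormedSpace ℝ E] [NormedAddCommGroup G] [NormedSpace ℝ G] {k : ℕ}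

/-- A smooth field of alternating forms evaluated on smooth vector fields is smooth: expand the
arguments in a basis. -/
theorem ContDiffAt.alternating_apply [FiniteDimensional ℝ E] {n : WithTop ℕ∞}
    {η : N → E [⋀^Fin k]→L[ℝ] ℝ}
    {v : N → Fin k → E} {y : N} (hη : ContDiffAt ℝ n η y)
    (hv : ∀ i, ContDiffAt ℝ n (fun z => v z i) y) : ContDiffAt ℝ n (fun z => η z (v z)) y := by
  classical
  let b := Module.finBasis ℝ E
  have key : ∀ z, η z (v z)
      = ∑ s : Fin k → Fin (Module.finrank ℝ E), (∏ i, b.repr (v z i) (s i)) * η z (b ∘ s) := by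
    intro z
    have h1 : v z = fun i => ∑ j, b.repr (v z i) j • b j := by
      ext1 i; exact (b.sum_repr (v z i)).symm
    conv_lhs => rw [h1]
    have h2 := (η z).toMultilinearMap.map_sum (fun i j => b.repr (v z i) j • b j)
    refine h2.trans (Finset.sum_congr rfl fun s _ => ?_)
    exact (η z).toMultilinearMap.map_smul_univ (fun i => b.repr (v z i) (s i)) (fun i => b (s i))
  simp_rw [key]
  refine ContDiffAt.sum fun s _ => ContDiffAt.mul (contDiffAt_prod fun i _ => ?_) ?_
  · have := (LinearMap.toContinuousLinearMap (b.coord (s i))).contDiff (n := n)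
    exact this.contDiffAt.comp y (hv i)
  · let L : (E [⋀^Fin k]→L[ℝ] ℝ) →L[ℝ] ℝ :=
      ContinuousAlternatingMap.apply ℝ E ℝ (b ∘ s)
    exact L.contDiff.contDiffAt.comp y hη

/-- On a finite-dimensional space, a field of alternating forms is smooth as soon as its values on
constant vectors are: finitely many evaluations embed the space of forms in some `ℝ^m`, and this
embedding has a linear left inverse. -/
theorem contDiffAt_alternating_of_apply [FiniteDimensional ℝ E] {n : WithTop ℕ∞}
    {η : N → E [⋀^Fin k]→L[ℝ] ℝ} {y : N}
    (h : ∀ v : Fin k → E, ContDiffAt ℝ n (fun z => η z v) y) : ContDiffAt ℝ n η y := by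
  classical
  let b := Module.finBasis ℝ E
  let L : (E [⋀^Fin k]→L[ℝ] ℝ) →ₗ[ℝ] ((Fin k → Fin (Module.finrank ℝ E)) → ℝ) :=
    { toFun := fun α s => α (b ∘ s)
      map_add' := fun _ _ => rfl
      map_smul' := fun _ _ => rfl }
  have hL : LinearMap.ker L = ⊥ := by
    rw [LinearMap.ker_eq_bot]
    intro α β hαβ
    apply ContinuousAlternatingMap.toAlternatingMap_injective
    apply AlternatingMap.coe_multilinearMap_injective
    exact Module.Basis.ext_multilinear (fun _ => b) fun s => congrFun hαβ s
  obtain ⟨R, hR⟩ := L.exists_leftInverse_of_injective hL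
  have hη : η = fun z => LinearMap.toContinuousLinearMap R (L (η z)) := by
    ext1 z
    exact (LinearMap.congr_fun hR (η z)).symm
  rw [hη]
  refine (LinearMap.toContinuousLinearMap R).contDiff.contDiffAt.comp y ?_
  exact contDiffAt_pi.2 fun s => h (b ∘ s)

theorem ContDiffAt.compContinuousLinearMap_alternating [FiniteDimensional ℝ E]
    [FiniteDimensional ℝ G] {n : WithTop ℕ∞}
    {η : N → E [⋀^Fin k]→L[ℝ] ℝ} {A : N → G →L[ℝ] E} {y : N}
    (hη : ContDiffAt ℝ n η y) (hA : ContDiffAt ℝ n A y) :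
    ContDiffAt ℝ n (fun z => (η z).compContinuousLinearMap (A z)) y := by
  refine contDiffAt_alternating_of_apply fun v => ?_
  exact hη.alternating_apply fun i => hA.clm_apply contDiffAt_const

/-- An alternating map that vanishes as soon as one of its arguments lies in `ker L` only depends
on the images of its arguments under `L`. -/
theorem ContinuousAlternatingMap.eq_of_map_eq {V W : Type*} [AddCommGroup V] [Module ℝ V]
    [TopologicalSpace V] [AddCommGroup W] [Module ℝ W] (m : V [⋀^Fin k]→L[ℝ] ℝ) (L : V →ₗ[ℝ] W)
    (hm : ∀ v i, L (v i) = 0 → m v = 0) {v w : Fin k → V} (h : ∀ i, L (v i) = L (w i)) :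
    m v = m w := by
  classical
  -- replace the arguments one at a time
  have key : ∀ s : Finset (Fin k), m (s.piecewise w v) = m v := by
    intro s
    induction s using Finset.induction_on with
    | empty => simp
    | insert a s ha ih =>
      rw [Finset.piecewise_insert, ← ih, ← sub_eq_zero]
      have h1 : s.piecewise w v = Function.update (s.piecewise w v) a (v a) := by
        rw [Function.eq_update_iff]; simp [ha]
      conv_lhs => rw [h1]
      rw [Function.update_idem, ← m.map_update_sub]
      exact hm _ a (by simp [h a])
  simpa using (key Finset.univ).symm

/-- An alternating map that vanishes when its first argument lies in `ker L` vanishes when any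
argument does. -/
theorem ContinuousAlternatingMap.eq_zero_of_first {V W : Type*} [AddCommGroup V] [Module ℝ V]
    [TopologicalSpace V] [AddCommGroup W] [Module ℝ W] (m : V [⋀^Fin (k + 1)]→L[ℝ] ℝ)
    (L : V →ₗ[ℝ] W) (hm : ∀ v, L (v 0) = 0 → m v = 0) (v : Fin (k + 1) → V) (i : Fin (k + 1))
    (h : L (v i) = 0) : m v = 0 := by
  by_cases hi : i = 0
  · subst hi; exact hm v h
  · have h1 := m.toAlternatingMap.map_swap v hi
    have h2 : m.toAlternatingMap (v ∘ Equiv.swap i 0) = 0 := hm _ (by simpa using h)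
    rw [h2] at h1
    exact neg_eq_zero.1 h1.symm

/-- Cartan's formula for a constant field `v`: a closed form which vanishes whenever its first
argument is `v` has zero derivative in the direction `v`. -/
theorem fderiv_eq_zero_of_extDeriv_eq_zero {η : E → E [⋀^Fin (k + 1)]→L[ℝ] ℝ} {y v : E}
    (hη : DifferentiableAt ℝ η y) (hd : extDeriv η y = 0)
    (hv : ∀ᶠ z in 𝓝 y, ∀ a : Fin (k + 1) → E, a 0 = v → η z a = 0) : fderiv ℝ η y v = 0 := by
  ext a
  have h := extDeriv_apply hη (Fin.cons v a : Fin (k + 2) → E)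
  rw [hd, Fin.sum_univ_succ, Finset.sum_eq_zero (s := Finset.univ)] at h
  · have h0 : (0 : Fin (k + 2)).removeNth (Fin.cons v a : Fin (k + 2) → E) = a := by
      ext j; simp [Fin.removeNth]
    rw [h0] at h
    have h1 := fderiv_continuousAlternatingMap_apply_const_apply hη a v
    rw [Fin.cons_zero, h1] at h
    simpa using h.symm
  · intro j _
    have : (fun z => η z (j.succ.removeNth (Fin.cons v a : Fin (k + 2) → E))) =ᶠ[𝓝 y]
        fun _ => 0 := by
      filter_upwards [hv] with z hz
      exact hz _ (by simp [Fin.removeNth])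
    rw [this.fderiv_eq]
    simp

/-- A map on a convex open set whose derivative vanishes on `ker q` is constant along the
translates of `ker q`. -/
theorem Convex.eq_of_fderiv_ker_eq_zero {f : E → G} {s : Set E} (hs : Convex ℝ s)
    (hf : ∀ y ∈ s, DifferentiableAt ℝ f y) (q : E →L[ℝ] N)
    (h : ∀ y ∈ s, ∀ v, q v = 0 → fderiv ℝ f y v = 0) {y z : E} (hy : y ∈ s) (hz : z ∈ s)
    (hyz : q y = q z) : f y = f z := by
  have hmem : ∀ t ∈ Set.Icc (0 : ℝ) 1, y + t • (z - y) ∈ s := fun t ht =>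
    hs.add_smul_sub_mem hy hz ht
  have hder : ∀ t ∈ Set.Icc (0 : ℝ) 1,
      HasDerivAt (fun t : ℝ => f (y + t • (z - y))) 0 t := by
    intro t ht
    have h1 : HasDerivAt (fun t : ℝ => y + t • (z - y)) (z - y) t := by
      simpa using ((hasDerivAt_id t).smul_const (z - y)).const_add y
    have h2 := (hf _ (hmem t ht)).hasFDerivAt.comp_hasDerivAt t h1
    rwa [h _ (hmem t ht) _ (by simp [hyz])] at h2
  have := constant_of_derivWithin_zero (f := fun t : ℝ => f (y + t • (z - y))) (a := 0) (b := 1)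
    (fun t ht => (hder t ht).differentiableAt.differentiableWithinAt)
    (fun t ht => (hder t (Set.Ico_subset_Icc_self ht)).hasDerivWithinAt.derivWithin
      (uniqueDiffOn_Icc zero_lt_one t (Set.Ico_subset_Icc_self ht)))
    1 (by simp)
  simpa using this.symm

end Linear

/-! ### Pullbacks under parametrizations, and naturality of the exterior derivative -/

section Pull

set_option linter.unusedSectionVars false

variable {N E F M B : Type*} [NormedAddCommGroup N] [NormedSpace ℝ N]
  [NormedAddCommGroup E] [NormedSpace ℝ E] [NormedAddCommGroup F] [NormedSpace ℝ F]
  [TopologicalSpace M] [ChartedSpace E M] [TopologicalSpace B] [ChartedSpace F B] {k : ℕ}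

/-- The pullback of a field of alternating forms on `M` under a map `g : N → M` from a normed
space. For the inverse of a chart this is `chartExpr`. -/
noncomputable def pull (g : N → M) (α : ∀ x : M, TangentSpace 𝓘(ℝ, E) x [⋀^Fin k]→L[ℝ] ℝ)
    (y : N) : N [⋀^Fin k]→L[ℝ] ℝ :=
  (α (g y)).compContinuousLinearMap (mfderiv 𝓘(ℝ, N) 𝓘(ℝ, E) g y)

theorem chartExpr_eq_pull (α : ∀ x : M, TangentSpace 𝓘(ℝ, E) x [⋀^Fin k]→L[ℝ] ℝ) (x₀ : M) :
    chartExpr α x₀ = pull (extChartAt 𝓘(ℝ, E) x₀).symm α := rfl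

variable [IsManifold 𝓘(ℝ, E) ∞ M] [IsManifold 𝓘(ℝ, F) ∞ B]

theorem contMDiffAt_extChartAt_symm_of_mem {x₀ : M} {y : E}
    (hy : y ∈ (extChartAt 𝓘(ℝ, E) x₀).target) :
    ContMDiffAt 𝓘(ℝ, E) 𝓘(ℝ, E) ∞ (extChartAt 𝓘(ℝ, E) x₀).symm y :=
  (contMDiffOn_extChartAt_symm x₀).contMDiffAt ((isOpen_extChartAt_target x₀).mem_nhds hy)

theorem contMDiffAt_extChartAt_of_mem {x₀ x : M}
    (hx : x ∈ (extChartAt 𝓘(ℝ, E) x₀).source) :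
    ContMDiffAt 𝓘(ℝ, E) 𝓘(ℝ, E) ∞ (extChartAt 𝓘(ℝ, E) x₀) x :=
  contMDiffAt_extChartAt' (by simpa using hx)

theorem mfderiv_extChartAt_symm_apply {x₀ x : M} (hx : x ∈ (extChartAt 𝓘(ℝ, E) x₀).source)
    (v : TangentSpace 𝓘(ℝ, E) x) :
    mfderiv 𝓘(ℝ, E) 𝓘(ℝ, E) (extChartAt 𝓘(ℝ, E) x₀).symm (extChartAt 𝓘(ℝ, E) x₀ x)
      (mfderiv 𝓘(ℝ, E) 𝓘(ℝ, E) (extChartAt 𝓘(ℝ, E) x₀) x v) = v := by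
  set φ := extChartAt 𝓘(ℝ, E) x₀
  have h1 : (φ.symm ∘ φ) =ᶠ[𝓝 x] id := by
    filter_upwards [(isOpen_extChartAt_source (I := 𝓘(ℝ, E)) x₀).mem_nhds hx] with z hz
    exact φ.left_inv hz
  have h2 := mfderiv_comp x
    ((contMDiffAt_extChartAt_symm_of_mem (φ.map_source hx)).mdifferentiableAt (by simp)) ((contMDiffAt_extChartAt_of_mem hx).mdifferentiableAt (by simp))
  rw [h1.mfderiv_eq, mfderiv_id] at h2
  exact (congrArg (fun L => L v) h2).symm

theorem mfderiv_extChartAt_apply_symm {x₀ : M} {y : E}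
    (hy : y ∈ (extChartAt 𝓘(ℝ, E) x₀).target) (v : E) :
    mfderiv 𝓘(ℝ, E) 𝓘(ℝ, E) (extChartAt 𝓘(ℝ, E) x₀) ((extChartAt 𝓘(ℝ, E) x₀).symm y)
      (mfderiv 𝓘(ℝ, E) 𝓘(ℝ, E) (extChartAt 𝓘(ℝ, E) x₀).symm y v) = v := by
  set φ := extChartAt 𝓘(ℝ, E) x₀
  have h1 : (φ ∘ φ.symm) =ᶠ[𝓝 y] id := by
    filter_upwards [(isOpen_extChartAt_target (I := 𝓘(ℝ, E)) x₀).mem_nhds hy] with z hz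
    exact φ.right_inv hz
  have h2 := mfderiv_comp y
    ((contMDiffAt_extChartAt_of_mem (φ.map_target hy)).mdifferentiableAt (by simp))
    ((contMDiffAt_extChartAt_symm_of_mem hy).mdifferentiableAt (by simp))
  rw [h1.mfderiv_eq, mfderiv_id] at h2
  exact (congrArg (fun L => L v) h2).symm

theorem ContMDiffAt.eventually_mdifferentiableAt {p : M → B} {x : M}
    (hp : ContMDiffAt 𝓘(ℝ, E) 𝓘(ℝ, F) ∞ p x) :
    ∀ᶠ z in 𝓝 x, MDifferentiableAt 𝓘(ℝ, E) 𝓘(ℝ, F) p z := by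
  have : IsManifold 𝓘(ℝ, E) 1 M := IsManifold.of_le (n := ∞) (by exact_mod_cast le_top)
  have : IsManifold 𝓘(ℝ, F) 1 B := IsManifold.of_le (n := ∞) (by exact_mod_cast le_top)
  have h1 : ContMDiffAt 𝓘(ℝ, E) 𝓘(ℝ, F) 1 p x := hp.of_le (by exact_mod_cast le_top)
  filter_upwards [(contMDiffAt_iff_contMDiffAt_nhds (by simp)).1 h1] with z hz
  exact hz.mdifferentiableAt (by simp)

/-- The chain rule for `pull`. -/
theorem pull_comp_eq {g : N → M} {p : M → B} {y : N}
    (hp : MDifferentiableAt 𝓘(ℝ, E) 𝓘(ℝ, F) p (g y))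
    (hg : MDifferentiableAt 𝓘(ℝ, N) 𝓘(ℝ, E) g y)
    (β : ∀ b : B, TangentSpace 𝓘(ℝ, F) b [⋀^Fin k]→L[ℝ] ℝ) :
    pull (p ∘ g) β y = pull g (fun x => (β (p x)).compContinuousLinearMap
      (mfderiv 𝓘(ℝ, E) 𝓘(ℝ, F) p x)) y := by
  ext v
  have h := mfderiv_comp y hp hg
  simp only [pull]
  rw [h]
  rfl

theorem pull_congr {g g' : N → M} {y : N} (h : g =ᶠ[𝓝 y] g')
    (α : ∀ x : M, TangentSpace 𝓘(ℝ, E) x [⋀^Fin k]→L[ℝ] ℝ) : pull g α =ᶠ[𝓝 y] pull g' α := by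
  filter_upwards [h.eventually_nhds] with z hz
  have h1 : g z = g' z := hz.self_of_nhds
  have h2 : mfderiv 𝓘(ℝ, N) 𝓘(ℝ, E) g z = mfderiv 𝓘(ℝ, N) 𝓘(ℝ, E) g' z :=
    Filter.EventuallyEq.mfderiv_eq hz
  ext v
  change (α (g z)) (fun i => mfderiv 𝓘(ℝ, N) 𝓘(ℝ, E) g z (v i))
    = (α (g' z)) (fun i => mfderiv 𝓘(ℝ, N) 𝓘(ℝ, E) g' z (v i))
  -- the tangent spaces at `g z` and `g' z` are both `E`, so the values can be compared there
  have key : ∀ (a b : M), a = b → ∀ w : Fin k → E, (α a : E [⋀^Fin k]→L[ℝ] ℝ) w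
      = (α b : E [⋀^Fin k]→L[ℝ] ℝ) w := by
    rintro a _ rfl w; rfl
  refine (key _ _ h1 _).trans ?_
  congr 1
  ext1 i
  exact congrArg (fun L : N →L[ℝ] E => L (v i)) h2

/-- Near `y`, the pullback under `g` is the pullback of the expression in the chart around `g y`
under the expression of `g` in that chart. -/
theorem pull_eventuallyEq {g : N → M} {y : N} (hg : ContMDiffAt 𝓘(ℝ, N) 𝓘(ℝ, E) ∞ g y)
    (α : ∀ x : M, TangentSpace 𝓘(ℝ, E) x [⋀^Fin k]→L[ℝ] ℝ) :
    pull g α =ᶠ[𝓝 y] fun z =>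
      (chartExpr α (g y) (extChartAt 𝓘(ℝ, E) (g y) (g z))).compContinuousLinearMap
        (fderiv ℝ (fun z => extChartAt 𝓘(ℝ, E) (g y) (g z)) z) := by
  set φ := extChartAt 𝓘(ℝ, E) (g y) with hφ
  have hsrc : ∀ᶠ z in 𝓝 y, g z ∈ φ.source :=
    hg.continuousAt.eventually (extChartAt_source_mem_nhds (g y))
  have h1 := hg.eventually_mdifferentiableAt
  have h2 : g =ᶠ[𝓝 y] φ.symm ∘ (fun z => φ (g z)) := by
    filter_upwards [hsrc] with z hz
    exact (φ.left_inv hz).symm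
  filter_upwards [pull_congr h2 α, hsrc, h1] with z hz hz1 hz2
  have hs : MDifferentiableAt 𝓘(ℝ, E) 𝓘(ℝ, E) φ.symm (φ (g z)) :=
    (contMDiffAt_extChartAt_symm_of_mem (φ.map_source hz1)).mdifferentiableAt (by simp)
  have hf : MDifferentiableAt 𝓘(ℝ, N) 𝓘(ℝ, E) (fun z => φ (g z)) z :=
    ((contMDiffAt_extChartAt_of_mem hz1).mdifferentiableAt (by simp)).comp z hz2
  rw [hz, pull_comp_eq (g := fun z => φ (g z)) hs hf, ← mfderiv_eq_fderiv]
  rfl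

theorem contDiffAt_extChartAt_comp {g : N → M} {y : N}
    (hg : ContMDiffAt 𝓘(ℝ, N) 𝓘(ℝ, E) ∞ g y) :
    ContDiffAt ℝ ∞ (fun z => extChartAt 𝓘(ℝ, E) (g y) (g z)) y :=
  ((contMDiffAt_extChartAt_of_mem (mem_extChartAt_source (g y))).comp y hg).contDiffAt

namespace DiffForm

theorem toFun_injective : Function.Injective (DiffForm.toFun (E := E) (M := M) (k := k)) := by
  rintro ⟨α, hα⟩ ⟨β, hβ⟩ rfl
  rfl

theorem contDiffAt_chartExpr (α : DiffForm E M k) {x₀ : M} {y : E}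
    (hy : y ∈ (extChartAt 𝓘(ℝ, E) x₀).target) : ContDiffAt ℝ ∞ (chartExpr α.toFun x₀) y :=
  (α.smooth x₀).contDiffAt ((isOpen_extChartAt_target x₀).mem_nhds hy)

theorem contDiffAt_pull [FiniteDimensional ℝ E] [FiniteDimensional ℝ N] (α : DiffForm E M k)
    {g : N → M} {y : N} (hg : ContMDiffAt 𝓘(ℝ, N) 𝓘(ℝ, E) ∞ g y) :
    ContDiffAt ℝ ∞ (pull g α.toFun) y := by
  refine ContDiffAt.congr_of_eventuallyEq ?_ (pull_eventuallyEq hg α.toFun)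
  have hf := contDiffAt_extChartAt_comp hg
  refine ContDiffAt.compContinuousLinearMap_alternating ?_ (hf.fderiv_right (m := ∞) le_rfl)
  exact (α.contDiffAt_chartExpr (mem_extChartAt_target (g y))).comp y hf

/-- Naturality of the exterior derivative under smooth parametrizations. -/
theorem extDeriv_pull (α : DiffForm E M k) {g : N → M} {y : N}
    (hg : ContMDiffAt 𝓘(ℝ, N) 𝓘(ℝ, E) ∞ g y) :
    extDeriv (pull g α.toFun) y = pull g α.d y := by
  rw [(pull_eventuallyEq hg α.toFun).extDeriv_eq]
  have hf := contDiffAt_extChartAt_comp hg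
  have hd : DifferentiableAt ℝ (chartExpr α.toFun (g y)) (extChartAt 𝓘(ℝ, E) (g y) (g y)) :=
    (α.contDiffAt_chartExpr (mem_extChartAt_target (g y))).differentiableAt (by simp)
  have h1 := extDeriv_pullback (f := fun z => extChartAt 𝓘(ℝ, E) (g y) (g z)) (r := ∞) hd hf
    (by simpa using two_le_smooth)
  refine h1.trans ?_
  have h2 := mfderiv_comp y
    ((contMDiffAt_extChartAt (I := 𝓘(ℝ, E)) (n := ∞) (x := g y)).mdifferentiableAt (by simp))
    (hg.mdifferentiableAt (by simp))
  ext v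
  change _ = extDeriv (chartExpr α.toFun (g y)) (extChartAt 𝓘(ℝ, E) (g y) (g y))
    (fun i => mfderiv 𝓘(ℝ, E) 𝓘(ℝ, E) (extChartAt 𝓘(ℝ, E) (g y)) (g y)
      (mfderiv 𝓘(ℝ, N) 𝓘(ℝ, E) g y (v i)))
  change extDeriv (chartExpr α.toFun (g y)) (extChartAt 𝓘(ℝ, E) (g y) (g y))
    (fun i => fderiv ℝ (fun z => extChartAt 𝓘(ℝ, E) (g y) (g z)) y (v i)) = _
  congr 1
  ext1 i
  rw [← mfderiv_eq_fderiv]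
  exact congrArg (fun L => L (v i)) h2

/-- The exterior derivative as a smooth form. -/
noncomputable def extD (α : DiffForm E M k) : DiffForm E M (k + 1) where
  toFun := α.d
  smooth x₀ := by
    intro y hy
    refine ContDiffAt.contDiffWithinAt ?_
    have h1 : chartExpr α.d x₀ =ᶠ[𝓝 y] extDeriv (chartExpr α.toFun x₀) := by
      filter_upwards [(isOpen_extChartAt_target (I := 𝓘(ℝ, E)) x₀).mem_nhds hy] with z hz
      exact (α.extDeriv_pull (contMDiffAt_extChartAt_symm_of_mem hz)).symm
    refine ContDiffAt.congr_of_eventuallyEq ?_ h1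
    have h2 := (α.contDiffAt_chartExpr hy).fderiv_right (m := ∞) le_rfl
    exact (ContinuousAlternatingMap.alternatizeUncurryFinCLM ℝ E ℝ).contDiff.contDiffAt.comp y h2

theorem extD_closed (α : DiffForm E M k) : α.extD.Closed := by
  intro x
  have h1 : chartExpr α.d x =ᶠ[𝓝 (extChartAt 𝓘(ℝ, E) x x)] extDeriv (chartExpr α.toFun x) := by
    filter_upwards [(isOpen_extChartAt_target (I := 𝓘(ℝ, E)) x).mem_nhds
      (mem_extChartAt_target x)] with z hz
    exact (α.extDeriv_pull (contMDiffAt_extChartAt_symm_of_mem hz)).symm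
  have h2 : extDeriv (chartExpr α.d x) (extChartAt 𝓘(ℝ, E) x x) = 0 := by
    rw [h1.extDeriv_eq]
    exact extDeriv_extDeriv_apply (α.contDiffAt_chartExpr (mem_extChartAt_target x))
      (by simpa using two_le_smooth)
  change (extDeriv (chartExpr α.d x) (extChartAt 𝓘(ℝ, E) x x)).compContinuousLinearMap
    (mfderiv 𝓘(ℝ, E) 𝓘(ℝ, E) (extChartAt 𝓘(ℝ, E) x) x) = 0
  rw [h2]
  rfl

/-- The pullback of a form under a smooth map. -/
noncomputable def pullback [FiniteDimensional ℝ E] [FiniteDimensional ℝ F] (p : M → B)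
    (hp : ContMDiff 𝓘(ℝ, E) 𝓘(ℝ, F) ∞ p) (β : DiffForm F B k) : DiffForm E M k where
  toFun := β.pullbackAt p
  smooth x₀ := by
    intro y hy
    refine ContDiffAt.contDiffWithinAt ?_
    have h1 : chartExpr (β.pullbackAt p) x₀ =ᶠ[𝓝 y]
        pull (p ∘ (extChartAt 𝓘(ℝ, E) x₀).symm) β.toFun := by
      filter_upwards [(isOpen_extChartAt_target (I := 𝓘(ℝ, E)) x₀).mem_nhds hy] with z hz
      exact (pull_comp_eq ((hp _).mdifferentiableAt (by simp))
        ((contMDiffAt_extChartAt_symm_of_mem hz).mdifferentiableAt (by simp)) β.toFun).symm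
    exact ContDiffAt.congr_of_eventuallyEq
      (β.contDiffAt_pull ((hp _).comp y (contMDiffAt_extChartAt_symm_of_mem hy))) h1

/-- Naturality of the exterior derivative: `d (p^* β) = p^* (d β)`. -/
theorem d_pullback [FiniteDimensional ℝ E] [FiniteDimensional ℝ F] {p : M → B}
    (hp : ContMDiff 𝓘(ℝ, E) 𝓘(ℝ, F) ∞ p) (β : DiffForm F B k) (x : M) :
    (β.pullback p hp).d x =
      (β.d (p x)).compContinuousLinearMap (mfderiv 𝓘(ℝ, E) 𝓘(ℝ, F) p x) := by
  set φ := extChartAt 𝓘(ℝ, E) x with hφ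
  have hmem : φ x ∈ φ.target := mem_extChartAt_target x
  have h1 : chartExpr (β.pullback p hp).toFun x =ᶠ[𝓝 (φ x)] pull (p ∘ φ.symm) β.toFun := by
    filter_upwards [(isOpen_extChartAt_target (I := 𝓘(ℝ, E)) x).mem_nhds hmem] with z hz
    exact (pull_comp_eq ((hp _).mdifferentiableAt (by simp))
      ((contMDiffAt_extChartAt_symm_of_mem hz).mdifferentiableAt (by simp)) β.toFun).symm
  have h2 := β.extDeriv_pull ((hp _).comp (φ x) (contMDiffAt_extChartAt_symm_of_mem hmem))
  rw [pull_comp_eq ((hp _).mdifferentiableAt (by simp))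
    ((contMDiffAt_extChartAt_symm_of_mem hmem).mdifferentiableAt (by simp)), ← h1.extDeriv_eq] at h2
  have hx : φ.symm (φ x) = x := φ.left_inv (mem_extChartAt_source x)
  have h3 : ∀ z, z = x → ∀ v : Fin (k + 1) → E,
      ((β.d (p z)).compContinuousLinearMap (mfderiv 𝓘(ℝ, E) 𝓘(ℝ, F) p z) :
        E [⋀^Fin (k + 1)]→L[ℝ] ℝ) v
      = ((β.d (p x)).compContinuousLinearMap (mfderiv 𝓘(ℝ, E) 𝓘(ℝ, F) p x) :
        E [⋀^Fin (k + 1)]→L[ℝ] ℝ) v := by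
    rintro z rfl v; rfl
  ext v
  change extDeriv (chartExpr (β.pullback p hp).toFun x) (φ x)
    (fun i => mfderiv 𝓘(ℝ, E) 𝓘(ℝ, E) φ x (v i)) = _
  rw [h2]
  refine (h3 _ hx _).trans ?_
  congr 1
  ext1 i
  exact mfderiv_extChartAt_symm_apply (mem_extChartAt_source x) (v i)

end DiffForm

end Pull

/-! ### Descent of closed horizontal forms along a submersion -/

section Descent

set_option linter.unusedSectionVars false

variable {E F M B : Type*} [NormedAddCommGroup E] [NormedSpace ℝ E]
  [NormedAddCommGroup F] [NormedSpace ℝ F]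
  [TopologicalSpace M] [ChartedSpace E M] [IsManifold 𝓘(ℝ, E) ∞ M]
  [TopologicalSpace B] [ChartedSpace F B] [IsManifold 𝓘(ℝ, F) ∞ B]

/-- The local normal form of a map `p` at `x`: a parametrization `par` of `M` near `x` and a chart
`coord` of `B` near `p x`, with inverse `coordInv`, in which `p` is a linear projection `proj`
with linear section `incl`. -/
structure SubmersionNormalForm (E F : Type*) {M B : Type*} [NormedAddCommGroup E] [NormedSpace ℝ E]
    [NormedAddCommGroup F] [NormedSpace ℝ F] [TopologicalSpace M] [ChartedSpace E M]
    [TopologicalSpace B] [ChartedSpace F B] (p : M → B) (x : M) where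
  par : E → M
  base : E
  dom : Set E
  proj : E →L[ℝ] F
  incl : F →L[ℝ] E
  coord : B → F
  coordInv : F → B
  isOpen_dom : IsOpen dom
  base_mem : base ∈ dom
  par_base : par base = x
  par_smooth : ∀ y ∈ dom, ContMDiffAt 𝓘(ℝ, E) 𝓘(ℝ, E) ∞ par y
  par_image : ∀ V ∈ 𝓝 base, par '' V ∈ 𝓝 x
  proj_incl : ∀ c, proj (incl c) = c
  coord_smooth : ContMDiffAt 𝓘(ℝ, F) 𝓘(ℝ, F) ∞ coord (p x)
  coordInv_smooth : ∀ y ∈ dom, ContMDiffAt 𝓘(ℝ, F) 𝓘(ℝ, F) ∞ coordInv (proj y)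
  map_par : ∀ y ∈ dom, p (par y) = coordInv (proj y)
  coord_map_par : ∀ y ∈ dom, coord (p (par y)) = proj y
  coordInv_coord : ∀ᶠ b in 𝓝 (p x), coordInv (coord b) = b

theorem Manifold.IsSubmersion.nonempty_normalForm {p : M → B}
    (hp : Manifold.IsSubmersion 𝓘(ℝ, E) 𝓘(ℝ, F) ∞ p) (x : M) :
    Nonempty (SubmersionNormalForm E F p x) := by
  obtain ⟨G, _, _, hG⟩ := hp
  have h := hG x
  set D := h.domChart.extend 𝓘(ℝ, E) with hD
  set C := h.codChart.extend 𝓘(ℝ, F) with hC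
  have hDs : D.source = h.domChart.source := h.domChart.extend_source
  have hCs : C.source = h.codChart.source := h.codChart.extend_source
  have hDt : IsOpen D.target := by
    rw [hD, OpenPartialHomeomorph.extend_target]
    simpa using h.domChart.open_target
  have hCt : IsOpen C.target := by
    rw [hC, OpenPartialHomeomorph.extend_target]
    simpa using h.codChart.open_target
  have hx : x ∈ D.source := hDs ▸ h.mem_domChart_source
  have hpar : ∀ y ∈ D.target, p (D.symm y) ∈ C.source := fun y hy => by
    rw [hCs]
    exact h.source_subset_preimage_source (hDs ▸ D.map_target hy)
  have hwr : ∀ y ∈ D.target, C (p (D.symm y)) = (h.equiv y).1 := fun y hy => h.writtenInCharts hy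
  have hDsm : ContMDiffOn 𝓘(ℝ, E) 𝓘(ℝ, E) ∞ D.symm D.target := by
    have h1 := contMDiffOn_extend_symm h.domChart_mem_maximalAtlas
    refine h1.mono ?_
    rw [hD, OpenPartialHomeomorph.extend_target]
    simp
  have hCsm : ContMDiffOn 𝓘(ℝ, F) 𝓘(ℝ, F) ∞ C.symm C.target := by
    have h1 := contMDiffOn_extend_symm h.codChart_mem_maximalAtlas
    refine h1.mono ?_
    rw [hC, OpenPartialHomeomorph.extend_target]
    simp
  refine ⟨{
    par := D.symm
    base := D x
    dom := D.target
    proj := (ContinuousLinearMap.fst ℝ F G).comp h.equiv.toContinuousLinearMap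
    incl := h.equiv.symm.toContinuousLinearMap.comp (ContinuousLinearMap.inl ℝ F G)
    coord := C
    coordInv := C.symm
    isOpen_dom := hDt
    base_mem := D.map_source hx
    par_base := D.left_inv hx
    par_smooth := fun y hy => hDsm.contMDiffAt (hDt.mem_nhds hy)
    par_image := ?_
    proj_incl := fun c => by simp
    coord_smooth := h.codChart.contMDiffAt_extend h.codChart_mem_maximalAtlas h.mem_codChart_source
    coordInv_smooth := ?_
    map_par := ?_
    coord_map_par := fun y hy => hwr y hy
    coordInv_coord := ?_ }⟩
  · intro V hV
    have hc : ContinuousAt D x := h.domChart.continuousAt_extend h.mem_domChart_source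
    filter_upwards [hc.preimage_mem_nhds hV,
      h.domChart.extend_source_mem_nhds (I := 𝓘(ℝ, E)) h.mem_domChart_source]
      with z hz hz'
    exact ⟨D z, hz, D.left_inv hz'⟩
  · intro y hy
    refine hCsm.contMDiffAt (hCt.mem_nhds ?_)
    have := C.map_source (hpar y hy)
    rwa [hwr y hy] at this
  · intro y hy
    have := C.left_inv (hpar y hy)
    rw [hwr y hy] at this
    exact this.symm
  · filter_upwards [h.codChart.extend_source_mem_nhds (I := 𝓘(ℝ, F)) h.mem_codChart_source]
      with b hb
    exact C.left_inv hb

namespace SubmersionNormalForm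

variable {p : M → B} {x : M} (n : SubmersionNormalForm E F p x)

theorem coord_base : n.coord (p x) = n.proj n.base := by
  have := n.coord_map_par _ n.base_mem
  rwa [n.par_base] at this

/-- The differential of `p`, in the normal form. -/
theorem mfderiv_map_par (hp : ContMDiff 𝓘(ℝ, E) 𝓘(ℝ, F) ∞ p) {y : E} (hy : y ∈ n.dom) (v : E) :
    mfderiv 𝓘(ℝ, E) 𝓘(ℝ, F) p (n.par y) (mfderiv 𝓘(ℝ, E) 𝓘(ℝ, E) n.par y v)
      = mfderiv 𝓘(ℝ, F) 𝓘(ℝ, F) n.coordInv (n.proj y) (n.proj v) := by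
  have h1 := mfderiv_comp y ((hp (n.par y)).mdifferentiableAt (by simp))
    ((n.par_smooth y hy).mdifferentiableAt (by simp))
  have h2 := mfderiv_comp (I := 𝓘(ℝ, E)) y ((n.coordInv_smooth y hy).mdifferentiableAt (by simp))
    n.proj.mdifferentiableAt
  have h3 : (p ∘ n.par) =ᶠ[𝓝 y] (n.coordInv ∘ n.proj) := by
    filter_upwards [n.isOpen_dom.mem_nhds hy] with z hz
    exact n.map_par z hz
  have h4 := h1.symm.trans ((show _ = _ from h3.mfderiv_eq).trans h2)
  rw [ContinuousLinearMap.mfderiv_eq] at h4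
  exact congrArg (fun L => L v) h4

/-- The chart `coord` has an invertible differential at `p x`. -/
theorem mfderiv_coordInv_coord (a : TangentSpace 𝓘(ℝ, F) (p x)) :
    mfderiv 𝓘(ℝ, F) 𝓘(ℝ, F) n.coordInv (n.proj n.base)
      (mfderiv 𝓘(ℝ, F) 𝓘(ℝ, F) n.coord (p x) a) = a := by
  have h1 := mfderiv_comp (p x) (g := n.coordInv) (f := n.coord)
    (by rw [n.coord_base]; exact (n.coordInv_smooth _ n.base_mem).mdifferentiableAt (by simp))
    (n.coord_smooth.mdifferentiableAt (by simp))
  have h2 : (n.coordInv ∘ n.coord) =ᶠ[𝓝 (p x)] id := n.coordInv_coord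
  rw [h2.mfderiv_eq, mfderiv_id, n.coord_base] at h1
  exact (congrArg (fun L => L a) h1).symm

end SubmersionNormalForm

/-- A submersion has smooth local sections through every point. -/
theorem Manifold.IsSubmersion.exists_localSection {p : M → B}
    (hp : Manifold.IsSubmersion 𝓘(ℝ, E) 𝓘(ℝ, F) ∞ p) (x : M) :
    ∃ s : B → M, ContMDiffAt 𝓘(ℝ, F) 𝓘(ℝ, E) ∞ s (p x) ∧ s (p x) = x ∧
      ∀ᶠ b in 𝓝 (p x), p (s b) = b := by
  obtain ⟨n⟩ := hp.nonempty_normalForm x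
  let t : B → E := fun b => n.base + n.incl (n.coord b - n.proj n.base)
  have ht : ContMDiffAt 𝓘(ℝ, F) 𝓘(ℝ, E) ∞ t (p x) := by
    have h1 : ContDiff ℝ ∞ (fun c : F => n.base + n.incl (c - n.proj n.base)) := by fun_prop
    exact h1.contMDiff.contMDiffAt.comp (p x) n.coord_smooth
  have ht0 : t (p x) = n.base := by simp [t, n.coord_base]
  refine ⟨fun b => n.par (t b), ?_, (congrArg n.par ht0).trans n.par_base, ?_⟩
  · refine ContMDiffAt.comp (p x) (g := n.par) ?_ ht
    rw [ht0]
    exact n.par_smooth _ n.base_mem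
  · have h1 : ∀ᶠ b in 𝓝 (p x), t b ∈ n.dom := by
      refine ht.continuousAt.eventually (n.isOpen_dom.mem_nhds ?_)
      rw [ht0]
      exact n.base_mem
    filter_upwards [h1, n.coordInv_coord] with b hb hb'
    rw [n.map_par _ hb]
    simp [t, n.proj_incl, hb']

/-- The differential of a submersion is surjective. -/
theorem Manifold.IsSubmersion.mfderiv_surjective {p : M → B}
    (hp : Manifold.IsSubmersion 𝓘(ℝ, E) 𝓘(ℝ, F) ∞ p) (x : M) :
    Function.Surjective (mfderiv 𝓘(ℝ, E) 𝓘(ℝ, F) p x) := by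
  obtain ⟨n⟩ := hp.nonempty_normalForm x
  intro a
  have h1 := n.mfderiv_map_par hp.contMDiff n.base_mem
    (n.incl (mfderiv 𝓘(ℝ, F) 𝓘(ℝ, F) n.coord (p x) a))
  have h2 := h1.trans ((congrArg _ (n.proj_incl _)).trans (n.mfderiv_coordInv_coord a))
  have key : ∀ z, z = x → ∀ w : E, ∃ w' : E, (mfderiv 𝓘(ℝ, E) 𝓘(ℝ, F) p x : E →L[ℝ] F) w'
      = (mfderiv 𝓘(ℝ, E) 𝓘(ℝ, F) p z : E →L[ℝ] F) w := by
    rintro z rfl w; exact ⟨w, rfl⟩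
  obtain ⟨w, hw⟩ := key _ n.par_base (mfderiv 𝓘(ℝ, E) 𝓘(ℝ, E) n.par n.base
    (n.incl (mfderiv 𝓘(ℝ, F) 𝓘(ℝ, F) n.coord (p x) a)))
  exact ⟨w, hw.trans h2⟩

/-- The form at `p x` obtained by inserting lifts of vectors, `lift` being a family of linear
right inverses of `dp`. All tangent spaces of `B` are identified with `F`, so that values over
different points can be compared. -/
noncomputable def liftedForm {k : ℕ} {p : M → B}
    (lift : ∀ x : M, TangentSpace 𝓘(ℝ, F) (p x) →L[ℝ] TangentSpace 𝓘(ℝ, E) x)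
    (T : DiffForm E M k) (x : M) : F [⋀^Fin k]→L[ℝ] ℝ :=
  (T x).compContinuousLinearMap (lift x)

section

variable {p : M → B} {k : ℕ}
  {lift : ∀ x : M, TangentSpace 𝓘(ℝ, F) (p x) →L[ℝ] TangentSpace 𝓘(ℝ, E) x}
  {T : DiffForm E M (k + 1)}

/-- A form which vanishes on vertical vectors is recovered from its values on lifts. -/
theorem liftedForm_apply_mfderiv
    (hlift : ∀ x u, mfderiv 𝓘(ℝ, E) 𝓘(ℝ, F) p x (lift x u) = u)
    (hT : ∀ x v, mfderiv 𝓘(ℝ, E) 𝓘(ℝ, F) p x (v 0) = 0 → T x v = 0) (x : M)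
    (v : Fin (k + 1) → TangentSpace 𝓘(ℝ, E) x) (w : Fin (k + 1) → F)
    (hvw : ∀ i, mfderiv 𝓘(ℝ, E) 𝓘(ℝ, F) p x (v i) = w i) : liftedForm lift T x w = T x v := by
  refine (T x).eq_of_map_eq (mfderiv 𝓘(ℝ, E) 𝓘(ℝ, F) p x).toLinearMap
    (fun u i hi => (T x).eq_zero_of_first _ (hT x) u i hi) fun i => ?_
  exact (hlift x (w i)).trans (hvw i).symm

/-- A closed form which vanishes on vertical vectors is, after identification of its values with
forms on the base, locally constant along the fibres: in the normal form of `p` its derivative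
in vertical directions vanishes. -/
theorem liftedForm_eventually_eq [FiniteDimensional ℝ E]
    (hp : Manifold.IsSubmersion 𝓘(ℝ, E) 𝓘(ℝ, F) ∞ p)
    (hlift : ∀ x u, mfderiv 𝓘(ℝ, E) 𝓘(ℝ, F) p x (lift x u) = u)
    (hT : ∀ x v, mfderiv 𝓘(ℝ, E) 𝓘(ℝ, F) p x (v 0) = 0 → T x v = 0) (hcl : T.Closed) (x : M) :
    ∀ᶠ z in 𝓝 x, p z = p x → liftedForm lift T z = liftedForm lift T x := by
  obtain ⟨n⟩ := hp.nonempty_normalForm x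
  obtain ⟨ε, hε, hball⟩ := Metric.isOpen_iff.1 n.isOpen_dom _ n.base_mem
  set V := Metric.ball n.base ε with hV
  have hdiff : ∀ y ∈ V, DifferentiableAt ℝ (pull n.par T.toFun) y := fun y hy =>
    (T.contDiffAt_pull (n.par_smooth y (hball hy))).differentiableAt (by simp)
  have hconst : ∀ y ∈ V, n.proj y = n.proj n.base →
      pull n.par T.toFun y = pull n.par T.toFun n.base := by
    intro y hy hy'
    refine (convex_ball n.base ε).eq_of_fderiv_ker_eq_zero hdiff n.proj ?_ hy
      (Metric.mem_ball_self hε) hy'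
    intro y hy v hv
    refine fderiv_eq_zero_of_extDeriv_eq_zero (hdiff y hy) ?_ ?_
    · rw [T.extDeriv_pull (n.par_smooth y (hball hy))]
      ext w
      change T.d (n.par y) _ = 0
      rw [hcl (n.par y)]
      rfl
    · filter_upwards [Metric.isOpen_ball.mem_nhds hy] with z hz a ha
      refine hT (n.par z) _ ?_
      refine (n.mfderiv_map_par hp.contMDiff (hball hz) (a 0)).trans ?_
      rw [ha, hv]
      exact map_zero _
  -- `T` at the point `par y` is determined by its pullback restricted to the range of `incl`
  have key : ∀ y ∈ V, n.proj y = n.proj n.base → ∀ c : Fin (k + 1) → F,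
      liftedForm lift T (n.par y)
        (fun i => mfderiv 𝓘(ℝ, F) 𝓘(ℝ, F) n.coordInv (n.proj n.base) (c i))
        = pull n.par T.toFun y (fun i => n.incl (c i)) := by
    intro y hy hy' c
    refine liftedForm_apply_mfderiv hlift hT (n.par y) _ _ fun i => ?_
    have := n.mfderiv_map_par hp.contMDiff (hball hy) (n.incl (c i))
    rw [n.proj_incl] at this
    refine this.trans ?_
    have aux : ∀ a b : F, a = b → ∀ c : F, (mfderiv 𝓘(ℝ, F) 𝓘(ℝ, F) n.coordInv a : F →L[ℝ] F) c
        = (mfderiv 𝓘(ℝ, F) 𝓘(ℝ, F) n.coordInv b : F →L[ℝ] F) c := by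
      rintro a _ rfl c; rfl
    exact aux _ _ hy' _
  filter_upwards [n.par_image V (Metric.ball_mem_nhds _ hε)] with z hz hzx
  obtain ⟨y, hy, rfl⟩ := hz
  have hy' : n.proj y = n.proj n.base := by
    rw [← n.coord_map_par y (hball hy), hzx, n.coord_base]
  ext a
  have ha : a = fun i => mfderiv 𝓘(ℝ, F) 𝓘(ℝ, F) n.coordInv (n.proj n.base)
      (mfderiv 𝓘(ℝ, F) 𝓘(ℝ, F) n.coord (p x) (a i)) := by
    ext1 i
    exact (n.mfderiv_coordInv_coord (a i)).symm
  have h1 := key y hy hy' fun i => mfderiv 𝓘(ℝ, F) 𝓘(ℝ, F) n.coord (p x) (a i)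
  have h2 := key n.base (Metric.mem_ball_self hε) rfl
    fun i => mfderiv 𝓘(ℝ, F) 𝓘(ℝ, F) n.coord (p x) (a i)
  rw [n.par_base] at h2
  rw [ha]
  refine h1.trans (Eq.trans ?_ h2.symm)
  rw [hconst y hy hy']

theorem liftedForm_eq_of_connected_fibres [FiniteDimensional ℝ E]
    (hp : Manifold.IsSubmersion 𝓘(ℝ, E) 𝓘(ℝ, F) ∞ p) (hfib : ∀ b : B, IsConnected (p ⁻¹' {b}))
    (hlift : ∀ x u, mfderiv 𝓘(ℝ, E) 𝓘(ℝ, F) p x (lift x u) = u)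
    (hT : ∀ x v, mfderiv 𝓘(ℝ, E) 𝓘(ℝ, F) p x (v 0) = 0 → T x v = 0) (hcl : T.Closed)
    {x z : M} (h : p z = p x) : liftedForm lift T z = liftedForm lift T x := by
  have : PreconnectedSpace (p ⁻¹' {p x}) :=
    Subtype.preconnectedSpace (hfib (p x)).isPreconnected
  have hlc : IsLocallyConstant (fun y : p ⁻¹' {p x} => liftedForm lift T y.1) := by
    rw [IsLocallyConstant.iff_eventually_eq]
    intro y
    have h1 := liftedForm_eventually_eq hp hlift hT hcl y.1
    filter_upwards [continuous_subtype_val.continuousAt.eventually h1] with w hw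
    exact hw ((show p w.1 = p x from w.2).trans (show p y.1 = p x from y.2).symm)
  exact hlc.apply_eq_of_preconnectedSpace ⟨z, h⟩ ⟨x, rfl⟩

/-- A closed form on the total space of a submersion with connected fibres which vanishes on
vertical vectors is the pullback of a closed form on the base. -/
theorem DiffForm.exists_eq_pullback [FiniteDimensional ℝ E] [FiniteDimensional ℝ F]
    (hp : Manifold.IsSubmersion 𝓘(ℝ, E) 𝓘(ℝ, F) ∞ p) (hfib : ∀ b : B, IsConnected (p ⁻¹' {b}))
    (hlift : ∀ x u, mfderiv 𝓘(ℝ, E) 𝓘(ℝ, F) p x (lift x u) = u)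
    (hT : ∀ x v, mfderiv 𝓘(ℝ, E) 𝓘(ℝ, F) p x (v 0) = 0 → T x v = 0) (hcl : T.Closed) :
    ∃ φ : DiffForm F B (k + 1), φ.Closed ∧ ∀ x, T x = φ.pullbackAt p x := by
  -- the value at `b` is read off at an arbitrary point of the fibre over `b`
  choose pt hpt using fun b => (hfib b).nonempty
  have hpt' : ∀ b, p (pt b) = b := hpt
  let φ₀ : ∀ b : B, TangentSpace 𝓘(ℝ, F) b [⋀^Fin (k + 1)]→L[ℝ] ℝ :=
    fun b => (liftedForm (F := F) lift T (pt b) : F [⋀^Fin (k + 1)]→L[ℝ] ℝ)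
  have hφ₀ : ∀ x, T x = (φ₀ (p x)).compContinuousLinearMap (mfderiv 𝓘(ℝ, E) 𝓘(ℝ, F) p x) := by
    intro x
    ext v
    have h1 := liftedForm_apply_mfderiv hlift hT x v _ fun i => rfl
    rw [← h1, liftedForm_eq_of_connected_fibres hp hfib hlift hT hcl (hpt' (p x)).symm]
    rfl
  have hpC := hp.contMDiff
  have hsmooth : ∀ b₀ : B, ContDiffOn ℝ ∞ (chartExpr φ₀ b₀) (extChartAt 𝓘(ℝ, F) b₀).target := by
    intro b₀ y hy
    refine ContDiffAt.contDiffWithinAt ?_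
    set ψ := extChartAt 𝓘(ℝ, F) b₀ with hψ
    obtain ⟨s, hs, -, hps⟩ := hp.exists_localSection (pt (ψ.symm y))
    rw [hpt'] at hs hps
    have hψs := contMDiffAt_extChartAt_symm_of_mem (E := F) (M := B) hy
    have hsψ : ContMDiffAt 𝓘(ℝ, F) 𝓘(ℝ, E) ∞ (s ∘ ψ.symm) y := hs.comp y hψs
    -- near `y`, the expression in the chart is the pullback of `T` under a local section
    have h1 : (p ∘ (s ∘ ψ.symm)) =ᶠ[𝓝 y] ψ.symm := hψs.continuousAt.eventually hps
    refine (T.contDiffAt_pull hsψ).congr_of_eventuallyEq ?_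
    filter_upwards [pull_congr h1 φ₀, hsψ.eventually_mdifferentiableAt] with z hz hz'
    rw [chartExpr_eq_pull, ← hz, pull_comp_eq ((hpC _).mdifferentiableAt (by simp)) hz']
    simp only [← hφ₀]
  let φ : DiffForm F B (k + 1) := ⟨φ₀, hsmooth⟩
  have hTφ : T = φ.pullback p hpC := DiffForm.toFun_injective (funext hφ₀)
  refine ⟨φ, fun b => ?_, hφ₀⟩
  obtain ⟨x, rfl⟩ : ∃ x, p x = b := ⟨pt b, hpt' b⟩
  have h1 := φ.d_pullback hpC x
  rw [← hTφ, hcl x] at h1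
  ext w
  choose v hv using fun i => hp.mfderiv_surjective x (w i)
  have h2 := congrArg (fun m => m v) h1
  have h3 : w = fun i => mfderiv 𝓘(ℝ, E) 𝓘(ℝ, F) p x (v i) := funext fun i => (hv i).symm
  rw [h3]
  exact h2.symm

end

end Descent

/-! ### Vector fields and the invariant formula for the exterior derivative -/

section Fields

set_option linter.unusedSectionVars false

variable {E F M B : Type*} [NormedAddCommGroup E] [NormedSpace ℝ E]
  [NormedAddCommGroup F] [NormedSpace ℝ F]
  [TopologicalSpace M] [ChartedSpace E M] [IsManifold 𝓘(ℝ, E) ∞ M]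
  [TopologicalSpace B] [ChartedSpace F B] [IsManifold 𝓘(ℝ, F) ∞ B]

/-- The invariant formula for the exterior derivative of a `2`-form on a normed space. -/
theorem extDeriv_two_apply {η : E → E [⋀^Fin 2]→L[ℝ] ℝ} {X Y Z : E → E} {y : E}
    (hη : DifferentiableAt ℝ η y) (hX : DifferentiableAt ℝ X y) (hY : DifferentiableAt ℝ Y y)
    (hZ : DifferentiableAt ℝ Z y) :
    extDeriv η y ![X y, Y y, Z y]
      = fderiv ℝ (fun z => η z ![Y z, Z z]) y (X y) - fderiv ℝ (fun z => η z ![X z, Z z]) y (Y y)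
        + fderiv ℝ (fun z => η z ![X z, Y z]) y (Z y) - η y ![lieBracket ℝ X Y y, Z y]
        + η y ![lieBracket ℝ X Z y, Y y] - η y ![lieBracket ℝ Y Z y, X y] := by
  have h := extDeriv_apply_vectorField (V := ![X, Y, Z]) hη (by
    intro i; fin_cases i <;> assumption)
  have e0 : ∀ z, (0 : Fin 3).removeNth (fun i => (![X, Y, Z] : Fin 3 → E → E) i z)
      = ![Y z, Z z] := by intro z; ext i; fin_cases i <;> rfl
  have e1 : ∀ z, (1 : Fin 3).removeNth (fun i => (![X, Y, Z] : Fin 3 → E → E) i z)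
      = ![X z, Z z] := by intro z; ext i; fin_cases i <;> rfl
  have e2 : ∀ z, (2 : Fin 3).removeNth (fun i => (![X, Y, Z] : Fin 3 → E → E) i z)
      = ![X z, Y z] := by intro z; ext i; fin_cases i <;> rfl
  have e : (fun i => (![X, Y, Z] : Fin 3 → E → E) i y) = ![X y, Y y, Z y] := by
    ext i; fin_cases i <;> rfl
  have i0 : Finset.Ici (0 : Fin 2) = {0, 1} := by decide
  have i1 : Finset.Ici (1 : Fin 2) = {1} := by decide
  have r0 : (0 : Fin 2).removeNth ((0 : Fin 2).castSucc.removeNth ![X y, Y y, Z y]) = ![Z y] := by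
    ext i; fin_cases i; rfl
  have r1 : (1 : Fin 2).removeNth ((0 : Fin 2).castSucc.removeNth ![X y, Y y, Z y]) = ![Y y] := by
    ext i; fin_cases i; rfl
  have r2 : (1 : Fin 2).removeNth ((1 : Fin 2).castSucc.removeNth ![X y, Y y, Z y]) = ![X y] := by
    ext i; fin_cases i; rfl
  rw [e] at h
  rw [h, Fin.sum_univ_three, Fin.sum_univ_two, i0, i1, Finset.sum_pair (by decide),
    Finset.sum_singleton]
  simp only [e0, e1, e2, r0, r1, r2]
  simp
  abel

/-- The coordinate field on the chart domain around `x₀` with constant coordinates `v`. -/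
noncomputable def coordField (x₀ : M) (v : E) (z : M) : TangentSpace 𝓘(ℝ, E) z :=
  (mfderiv 𝓘(ℝ, E) 𝓘(ℝ, E) (extChartAt 𝓘(ℝ, E) x₀).symm (extChartAt 𝓘(ℝ, E) x₀ z) : E →L[ℝ] E) v

theorem mfderiv_extChartAt_coordField {x₀ z : M} (hz : z ∈ (extChartAt 𝓘(ℝ, E) x₀).source)
    (v : E) : mfderiv 𝓘(ℝ, E) 𝓘(ℝ, E) (extChartAt 𝓘(ℝ, E) x₀) z (coordField x₀ v z) = v := by
  have h := mfderiv_extChartAt_apply_symm ((extChartAt 𝓘(ℝ, E) x₀).map_source hz) v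
  have key : ∀ z' : M, z' = z → ∀ w : E,
      (mfderiv 𝓘(ℝ, E) 𝓘(ℝ, E) (extChartAt 𝓘(ℝ, E) x₀) z' : E →L[ℝ] E) w
      = (mfderiv 𝓘(ℝ, E) 𝓘(ℝ, E) (extChartAt 𝓘(ℝ, E) x₀) z : E →L[ℝ] E) w := by
    rintro z' rfl w; rfl
  exact (key _ ((extChartAt 𝓘(ℝ, E) x₀).left_inv hz) _).symm.trans h

/-- The preferred trivialization of the tangent bundle is the differential of the chart. -/
theorem trivializationAt_snd {x₀ z : M} (hz : z ∈ (extChartAt 𝓘(ℝ, E) x₀).source)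
    (w : TangentSpace 𝓘(ℝ, E) z) :
    (trivializationAt E (TangentSpace 𝓘(ℝ, E)) x₀ ⟨z, w⟩).2
      = mfderiv 𝓘(ℝ, E) 𝓘(ℝ, E) (extChartAt 𝓘(ℝ, E) x₀) z w := by
  have : IsManifold 𝓘(ℝ, E) 1 M := IsManifold.of_le (n := ∞) (by exact_mod_cast le_top)
  have hz' : z ∈ (chartAt E x₀).source := by simpa using hz
  have h := congrArg (fun L => L w)
    (TangentBundle.continuousLinearMapAt_trivializationAt (I := 𝓘(ℝ, E)) hz')
  refine Eq.trans ?_ h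
  change _ = (trivializationAt E (TangentSpace 𝓘(ℝ, E)) x₀).linearMapAt ℝ z w
  rw [Bundle.Trivialization.coe_linearMapAt_of_mem]
  simpa using hz'

theorem contMDiffOn_coordField (x₀ : M) (v : E) :
    CMDiff[(extChartAt 𝓘(ℝ, E) x₀).source] ∞ (T% (coordField x₀ v)) := by
  have hb : (trivializationAt E (TangentSpace 𝓘(ℝ, E)) x₀).baseSet
      = (extChartAt 𝓘(ℝ, E) x₀).source := by simp
  rw [← hb, Bundle.Trivialization.contMDiffOn_section_baseSet_iff]
  refine (contMDiffOn_const (c := v)).congr fun z hz => ?_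
  rw [hb] at hz
  rw [trivializationAt_snd hz]
  exact mfderiv_extChartAt_coordField hz v

/-- Expansion of a tangent vector in the coordinate fields. -/
theorem eq_sum_coordField {ι : Type*} [Fintype ι] (b : Module.Basis ι ℝ E) {x₀ z : M}
    (hz : z ∈ (extChartAt 𝓘(ℝ, E) x₀).source) (w : TangentSpace 𝓘(ℝ, E) z) :
    w = ∑ i, b.repr (mfderiv 𝓘(ℝ, E) 𝓘(ℝ, E) (extChartAt 𝓘(ℝ, E) x₀) z w) i •
      coordField x₀ (b i) z := by
  have h := mfderiv_extChartAt_symm_apply hz w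
  have h2 := b.sum_repr (mfderiv 𝓘(ℝ, E) 𝓘(ℝ, E) (extChartAt 𝓘(ℝ, E) x₀) z w : E)
  refine h.symm.trans ?_
  refine (congrArg (mfderiv 𝓘(ℝ, E) 𝓘(ℝ, E) (extChartAt 𝓘(ℝ, E) x₀).symm
    (extChartAt 𝓘(ℝ, E) x₀ z) : E →L[ℝ] E) h2.symm).trans ?_
  have h3 : ∀ (L : E →L[ℝ] E) (c : ι → ℝ), L (∑ i, c i • b i) = ∑ i, c i • L (b i) := by
    intro L c; simp
  exact h3 _ _

/-- Germs of vector fields extend to global fields. -/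
theorem VField.exists_eventuallyEq [FiniteDimensional ℝ E] [T2Space M]
    {σ : ∀ x : M, TangentSpace 𝓘(ℝ, E) x} {U : Set M} (hU : IsOpen U) {x : M} (hx : x ∈ U)
    (hσ : CMDiff[U] ∞ (T% σ)) : ∃ X : VField E M, ∀ᶠ z in 𝓝 x, X z = σ z := by
  obtain ⟨f, -, hf⟩ := (SmoothBumpFunction.nhds_basis_tsupport (I := 𝓘(ℝ, E)) x).mem_iff.1
    (hU.mem_nhds hx)
  have h := ContMDiffOn.smul_section_of_tsupport (ψ := (f : M → ℝ)) f.contMDiff.contMDiffOn hU hf hσ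
  refine ⟨⟨_, h⟩, ?_⟩
  filter_upwards [f.eventuallyEq_one] with z hz
  change f z • σ z = σ z
  rw [hz]
  exact one_smul ℝ _

theorem VField.exists_eventuallyEq_coordField [FiniteDimensional ℝ E] [T2Space M] {x₀ x : M}
    (hx : x ∈ (extChartAt 𝓘(ℝ, E) x₀).source) (v : E) :
    ∃ X : VField E M, ∀ᶠ z in 𝓝 x, X z = coordField x₀ v z :=
  VField.exists_eventuallyEq (isOpen_extChartAt_source x₀) hx (contMDiffOn_coordField x₀ v)

theorem VField.exists_apply_eq [FiniteDimensional ℝ E] [T2Space M] (x : M)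
    (w : TangentSpace 𝓘(ℝ, E) x) : ∃ X : VField E M, X x = w := by
  have hx := mem_extChartAt_source (I := 𝓘(ℝ, E)) x
  obtain ⟨X, hX⟩ := VField.exists_eventuallyEq_coordField hx
    (mfderiv 𝓘(ℝ, E) 𝓘(ℝ, E) (extChartAt 𝓘(ℝ, E) x) x w)
  exact ⟨X, hX.self_of_nhds.trans (mfderiv_extChartAt_symm_apply hx w)⟩

theorem VField.deriv_zero (X : VField E M) (x : M) : X.deriv (fun _ => 0) x = 0 := by
  rw [VField.deriv, mfderiv_const]
  rfl

theorem VField.deriv_neg (X : VField E M) (f : M → ℝ) (x : M) :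
    X.deriv (fun z => - f z) x = - X.deriv f x := by
  have h := mfderiv_neg (I := 𝓘(ℝ, E)) (f := f) (x := x)
  exact congrArg (fun L => L (X x)) h

/-- Smoothness of a field of forms may be tested on global vector fields. -/
theorem contDiffOn_chartExpr_of_vField [FiniteDimensional ℝ E] [T2Space M] {k : ℕ}
    (α : ∀ x : M, TangentSpace 𝓘(ℝ, E) x [⋀^Fin k]→L[ℝ] ℝ)
    (h : ∀ X : Fin k → VField E M, ContMDiff 𝓘(ℝ, E) 𝓘(ℝ, ℝ) ∞ fun x => α x fun i => X i x)
    (x₀ : M) : ContDiffOn ℝ ∞ (chartExpr α x₀) (extChartAt 𝓘(ℝ, E) x₀).target := by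
  intro y hy
  refine ContDiffAt.contDiffWithinAt (contDiffAt_alternating_of_apply fun v => ?_)
  have hsm := contMDiffAt_extChartAt_symm_of_mem hy
  choose X hX using fun i => VField.exists_eventuallyEq_coordField
    ((extChartAt 𝓘(ℝ, E) x₀).map_target hy) (v i)
  refine (((h X _).comp y hsm).contDiffAt).congr_of_eventuallyEq ?_
  filter_upwards [hsm.continuousAt.eventually (Filter.eventually_all.2 hX),
    (isOpen_extChartAt_target x₀).mem_nhds hy] with z hz hz'
  change α _ _ = α _ _
  congr 1
  ext1 i
  rw [hz i, coordField, (extChartAt 𝓘(ℝ, E) x₀).right_inv hz']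
  rfl

/-- The coordinates of `dp (X)` in a chart of the base are smooth. -/
theorem contMDiffAt_mfderiv_coord {p : M → B} (hp : ContMDiff 𝓘(ℝ, E) 𝓘(ℝ, F) ∞ p)
    (X : VField E M) (x : M) :
    ContMDiffAt 𝓘(ℝ, E) 𝓘(ℝ, F) ∞ (fun z =>
      (mfderiv 𝓘(ℝ, F) 𝓘(ℝ, F) (extChartAt 𝓘(ℝ, F) (p x)) (p z) : F →L[ℝ] F)
        (mfderiv 𝓘(ℝ, E) 𝓘(ℝ, F) p z (X z))) x := by
  have h1 := hp.contMDiff_tangentMap (m := ∞) (by simp)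
  have h2 := (h1.comp X.contMDiff) x
  rw [Bundle.contMDiffAt_totalSpace] at h2
  refine h2.2.congr_of_eventuallyEq ?_
  filter_upwards [hp.continuous.continuousAt.eventually
    (extChartAt_source_mem_nhds (I := 𝓘(ℝ, F)) (p x))] with z hz
  exact (trivializationAt_snd hz _).symm

/-- Near `x` the field `dp (X)` along `p` is a combination of global fields of `B`, with smooth
coefficients. -/
theorem exists_mfderiv_eq_sum [FiniteDimensional ℝ F] [T2Space B] (x : M) (p : M → B)
    (hp : ContMDiff 𝓘(ℝ, E) 𝓘(ℝ, F) ∞ p) :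
    ∃ (d : ℕ) (u : Fin d → VField F B), ∀ X : VField E M, ∃ c : Fin d → M → ℝ,
      (∀ i, ContMDiffAt 𝓘(ℝ, E) 𝓘(ℝ, ℝ) ∞ (c i) x) ∧
      ∀ᶠ z in 𝓝 x, mfderiv 𝓘(ℝ, E) 𝓘(ℝ, F) p z (X z) = ∑ i, c i z • u i (p z) := by
  let b := Module.finBasis ℝ F
  choose u hu using fun i => VField.exists_eventuallyEq_coordField (M := B)
    (mem_extChartAt_source (I := 𝓘(ℝ, F)) (p x)) (b i)
  refine ⟨_, u, fun X => ⟨fun i z => b.repr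
    ((mfderiv 𝓘(ℝ, F) 𝓘(ℝ, F) (extChartAt 𝓘(ℝ, F) (p x)) (p z) : F →L[ℝ] F)
      (mfderiv 𝓘(ℝ, E) 𝓘(ℝ, F) p z (X z))) i, fun i => ?_, ?_⟩⟩
  · exact (LinearMap.toContinuousLinearMap (b.coord i)).contMDiff.contMDiffAt.comp x
      (contMDiffAt_mfderiv_coord hp X x)
  · filter_upwards [hp.continuous.continuousAt.eventually
      (extChartAt_source_mem_nhds (I := 𝓘(ℝ, F)) (p x)),
      hp.continuous.continuousAt.eventually (Filter.eventually_all.2 hu)] with z hz hz'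
    refine (eq_sum_coordField b hz _).trans ?_
    refine Finset.sum_congr rfl fun i _ => ?_
    rw [hz' i]

/-- The expression of a vector field in the chart around `x`. -/
noncomputable def chartField (x : M) (X : ∀ x : M, TangentSpace 𝓘(ℝ, E) x) : E → E :=
  mpullbackWithin 𝓘(ℝ, E) 𝓘(ℝ, E) (extChartAt 𝓘(ℝ, E) x).symm X (Set.range 𝓘(ℝ, E))

section ChartField

variable [FiniteDimensional ℝ E]

theorem chartField_spec (x : M) (X : VField E M) : ∀ᶠ z in 𝓝 x,
    mfderiv 𝓘(ℝ, E) 𝓘(ℝ, E) (extChartAt 𝓘(ℝ, E) x) z (X z)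
      = chartField x X (extChartAt 𝓘(ℝ, E) x z) := by
  have : CompleteSpace E := FiniteDimensional.complete ℝ E
  have : IsManifold 𝓘(ℝ, E) 1 M := IsManifold.of_le (n := ∞) (by exact_mod_cast le_top)
  have := eventuallyEq_mpullback_mpullbackWithin_extChartAt (I := 𝓘(ℝ, E)) (s := Set.univ)
    (x := x) (V := X)
  rw [nhdsWithin_univ] at this
  filter_upwards [this, extChartAt_source_mem_nhds (I := 𝓘(ℝ, E)) x] with z hz hz'
  rw [hz, mpullback_apply]
  exact (isInvertible_mfderiv_extChartAt hz').self_apply_inverse _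

theorem differentiableAt_chartField (x : M) (X : VField E M) :
    DifferentiableAt ℝ (chartField x X) (extChartAt 𝓘(ℝ, E) x x) := by
  have : CompleteSpace E := FiniteDimensional.complete ℝ E
  have : IsManifold 𝓘(ℝ, E) 2 M := IsManifold.of_le (n := ∞) two_le_smooth
  have h := ((X.contMDiff x).mdifferentiableAt (by simp)).mdifferentiableWithinAt (s := Set.univ)
    |>.differentiableWithinAt_mpullbackWithin_vectorField
  have hs : ((extChartAt 𝓘(ℝ, E) x).symm ⁻¹' Set.univ ∩ Set.range 𝓘(ℝ, E)) = Set.univ := by simp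
  rw [hs] at h
  exact (differentiableWithinAt_univ (f := chartField x X)).1 h

theorem mfderiv_extChartAt_bracket (x : M) (X Y : VField E M) :
    mfderiv 𝓘(ℝ, E) 𝓘(ℝ, E) (extChartAt 𝓘(ℝ, E) x) x (X.bracket Y x)
      = lieBracket ℝ (chartField x X) (chartField x Y) (extChartAt 𝓘(ℝ, E) x x) := by
  have : IsManifold 𝓘(ℝ, E) 1 M := IsManifold.of_le (n := ∞) (by exact_mod_cast le_top)
  have iφ := isInvertible_mfderiv_extChartAt (I := 𝓘(ℝ, E)) (mem_extChartAt_source (I := 𝓘(ℝ, E)) x)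
  have hs : ((extChartAt 𝓘(ℝ, E) x).symm ⁻¹' Set.univ ∩ Set.range 𝓘(ℝ, E)) = Set.univ := by simp
  change mfderiv 𝓘(ℝ, E) 𝓘(ℝ, E) (extChartAt 𝓘(ℝ, E) x) x (mlieBracket 𝓘(ℝ, E) X Y x) = _
  rw [← mlieBracketWithin_univ, mlieBracketWithin_apply]
  refine (iφ.self_apply_inverse _).trans ?_
  rw [hs]
  exact congrFun (lieBracketWithin_univ (V := chartField x X) (W := chartField x Y)) _

theorem chartExpr_apply_mfderiv {k : ℕ} (α : DiffForm E M k) {x z : M}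
    (hz : z ∈ (extChartAt 𝓘(ℝ, E) x).source) (v : Fin k → TangentSpace 𝓘(ℝ, E) z) :
    chartExpr α.toFun x (extChartAt 𝓘(ℝ, E) x z)
      (fun i => mfderiv 𝓘(ℝ, E) 𝓘(ℝ, E) (extChartAt 𝓘(ℝ, E) x) z (v i)) = α z v := by
  have key : ∀ z' : M, z' = z → ∀ w : Fin k → E,
      (α z' : E [⋀^Fin k]→L[ℝ] ℝ) w = (α z : E [⋀^Fin k]→L[ℝ] ℝ) w := by
    rintro z' rfl w; rfl
  refine (key _ ((extChartAt 𝓘(ℝ, E) x).left_inv hz) _).trans ?_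
  congr 1
  ext1 i
  exact mfderiv_extChartAt_symm_apply hz (v i)

/-- The derivative of `α(Y, Z)` along `X`, computed in a chart. -/
theorem VField.deriv_apply_eq_fderiv (α : DiffForm E M 2) (X Y Z : VField E M) (x : M) :
    X.deriv (fun z => α z ![Y z, Z z]) x
      = fderiv ℝ (fun y => chartExpr α.toFun x y ![chartField x Y y, chartField x Z y])
        (extChartAt 𝓘(ℝ, E) x x) (chartField x X (extChartAt 𝓘(ℝ, E) x x)) := by
  set φ := extChartAt 𝓘(ℝ, E) x with hφ
  set f : E → ℝ := fun y => chartExpr α.toFun x y ![chartField x Y y, chartField x Z y] with hf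
  have h1 : (fun z => α z ![Y z, Z z]) =ᶠ[𝓝 x] f ∘ φ := by
    filter_upwards [chartField_spec x Y, chartField_spec x Z,
      extChartAt_source_mem_nhds (I := 𝓘(ℝ, E)) x] with z hY hZ hz
    rw [← chartExpr_apply_mfderiv α hz]
    simp only [hf, Function.comp]
    rw [← hY, ← hZ]
    congr 1
    ext1 i
    fin_cases i <;> rfl
  have hd : DifferentiableAt ℝ f (φ x) := by
    refine DifferentiableAt.continuousAlternatingMap_apply
      ((α.contDiffAt_chartExpr (mem_extChartAt_target x)).differentiableAt (by simp)) fun i => ?_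
    fin_cases i
    · exact differentiableAt_chartField x Y
    · exact differentiableAt_chartField x Z
  have h2 := mfderiv_comp x hd.mdifferentiableAt
    ((contMDiffAt_extChartAt (I := 𝓘(ℝ, E)) (n := ∞) (x := x)).mdifferentiableAt (by simp))
  have h3 := (show _ = _ from h1.mfderiv_eq (I := 𝓘(ℝ, E)) (I' := 𝓘(ℝ, ℝ))).trans h2
  rw [mfderiv_eq_fderiv] at h3
  refine (congrArg (fun L => L (X x)) h3).trans ?_
  exact congrArg (fderiv ℝ f (φ x)) (chartField_spec x X).self_of_nhds

/-- The invariant formula for the exterior derivative of a `2`-form. -/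
theorem DiffForm.d_apply_vField (α : DiffForm E M 2) (X Y Z : VField E M) (x : M) :
    α.d x ![X x, Y x, Z x]
      = X.deriv (fun z => α z ![Y z, Z z]) x - Y.deriv (fun z => α z ![X z, Z z]) x
        + Z.deriv (fun z => α z ![X z, Y z]) x - α x ![X.bracket Y x, Z x]
        + α x ![X.bracket Z x, Y x] - α x ![Y.bracket Z x, X x] := by
  have hsrc := mem_extChartAt_source (I := 𝓘(ℝ, E)) x
  have hX := (chartField_spec x X).self_of_nhds
  have hY := (chartField_spec x Y).self_of_nhds
  have hZ := (chartField_spec x Z).self_of_nhds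
  have key : ∀ a b : TangentSpace 𝓘(ℝ, E) x, α x ![a, b]
      = chartExpr α.toFun x (extChartAt 𝓘(ℝ, E) x x)
        ![mfderiv 𝓘(ℝ, E) 𝓘(ℝ, E) (extChartAt 𝓘(ℝ, E) x) x a,
          mfderiv 𝓘(ℝ, E) 𝓘(ℝ, E) (extChartAt 𝓘(ℝ, E) x) x b] := by
    intro a b
    rw [← chartExpr_apply_mfderiv α hsrc]
    congr 1
    ext1 i
    fin_cases i <;> rfl
  have h := extDeriv_two_apply
    ((α.contDiffAt_chartExpr (mem_extChartAt_target x)).differentiableAt (by simp))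
    (differentiableAt_chartField x X) (differentiableAt_chartField x Y)
    (differentiableAt_chartField x Z)
  rw [VField.deriv_apply_eq_fderiv, VField.deriv_apply_eq_fderiv, VField.deriv_apply_eq_fderiv,
    key, key, key, mfderiv_extChartAt_bracket, mfderiv_extChartAt_bracket,
    mfderiv_extChartAt_bracket, hX, hY, hZ, ← h]
  change extDeriv (chartExpr α.toFun x) (extChartAt 𝓘(ℝ, E) x x)
    (fun i => mfderiv 𝓘(ℝ, E) 𝓘(ℝ, E) (extChartAt 𝓘(ℝ, E) x) x
      ((![X x, Y x, Z x] : Fin 3 → TangentSpace 𝓘(ℝ, E) x) i)) = _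
  congr 1
  ext1 i
  fin_cases i
  · exact hX
  · exact hY
  · exact hZ

end ChartField

end Fields

/-! ### The form determined by a connection and a Hamiltonian of its curvature -/

section Alternating

variable {V : Type*} [AddCommGroup V] [Module ℝ V] [TopologicalSpace V]

theorem ContinuousAlternatingMap.apply_two_swap (m : V [⋀^Fin 2]→L[ℝ] ℝ) (a b : V) :
    m ![a, b] = - m ![b, a] := by
  have h := m.toAlternatingMap.map_swap ![b, a] (show (0 : Fin 2) ≠ 1 by decide)
  refine Eq.trans (congrArg m ?_) h
  ext i; fin_cases i <;> rfl

theorem ContinuousAlternatingMap.apply_three_swap (m : V [⋀^Fin 3]→L[ℝ] ℝ) (a b c : V) :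
    m ![a, b, c] = - m ![b, a, c] := by
  have h := m.toAlternatingMap.map_swap ![b, a, c] (show (0 : Fin 3) ≠ 1 by decide)
  refine Eq.trans (congrArg m ?_) h
  ext i; fin_cases i <;> rfl

theorem ContinuousAlternatingMap.apply_three_swap' (m : V [⋀^Fin 3]→L[ℝ] ℝ) (a b c : V) :
    m ![a, b, c] = - m ![a, c, b] := by
  have h := m.toAlternatingMap.map_swap ![a, c, b] (show (1 : Fin 3) ≠ 2 by decide)
  refine Eq.trans (congrArg m ?_) h
  ext i; fin_cases i <;> rfl

theorem ContinuousAlternatingMap.apply_three_add (m : V [⋀^Fin 3]→L[ℝ] ℝ) (a b c c' : V) :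
    m ![a, b, c + c'] = m ![a, b, c] + m ![a, b, c'] := by
  have h := m.toAlternatingMap.map_update_add ![a, b, c] 2 c c'
  have e : ∀ x : V, Function.update ![a, b, c] 2 x = ![a, b, x] := by
    intro x; ext i; fin_cases i <;> rfl
  rw [e, e, e] at h
  exact h

theorem ContinuousAlternatingMap.apply_three_add' (m : V [⋀^Fin 3]→L[ℝ] ℝ) (a b b' c : V) :
    m ![a, b + b', c] = m ![a, b, c] + m ![a, b', c] := by
  rw [m.apply_three_swap', m.apply_three_add, m.apply_three_swap' a c, m.apply_three_swap' a c]
  ring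

theorem ContinuousAlternatingMap.apply_two_sum {ι : Type*} [Fintype ι] (m : V [⋀^Fin 2]→L[ℝ] ℝ)
    (c d : ι → ℝ) (e : ι → V) :
    m ![∑ i, c i • e i, ∑ i, d i • e i] = ∑ i, ∑ j, c i * d j * m ![e i, e j] := by
  have hl : ∀ y : V, ∃ L : V →ₗ[ℝ] ℝ, ∀ x, L x = m ![x, y] := fun y =>
    ⟨{ toFun := fun x => m ![x, y]
       map_add' := fun x x' => m.toMultilinearMap.cons_add ![y] x x'
       map_smul' := fun r x => m.toMultilinearMap.cons_smul ![y] r x }, fun _ => rfl⟩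
  have hsum : ∀ (a : ι → ℝ) (y : V), m ![∑ i, a i • e i, y] = ∑ i, a i * m ![e i, y] := by
    intro a y
    obtain ⟨L, hL⟩ := hl y
    simp [← hL]
  rw [hsum]
  refine Finset.sum_congr rfl fun i _ => ?_
  rw [m.apply_two_swap, hsum, ← Finset.sum_neg_distrib, Finset.mul_sum]
  refine Finset.sum_congr rfl fun j _ => ?_
  rw [m.apply_two_swap (e i) (e j)]
  ring

end Alternating

section Coupling

variable {E F M B : Type*} [NormedAddCommGroup E] [NormedSpace ℝ E]
  [NormedAddCommGroup F] [NormedSpace ℝ F]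
  [TopologicalSpace M] [ChartedSpace E M] [IsManifold 𝓘(ℝ, E) ∞ M]
  [TopologicalSpace B] [ChartedSpace F B] [IsManifold 𝓘(ℝ, F) ∞ B]
  {p : M → B}

namespace EhresmannConnection

variable (H : EhresmannConnection E F p)

/-- The projection onto the vertical space along the horizontal space. -/
noncomputable def verProj (x : M) : TangentSpace 𝓘(ℝ, E) x →L[ℝ] Ver E F p x :=
  (ContinuousLinearMap.id ℝ (TangentSpace 𝓘(ℝ, E) x)
    - (H.lift x).comp (mfderiv 𝓘(ℝ, E) 𝓘(ℝ, F) p x)).codRestrict (Ver E F p x) fun v => by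
      refine LinearMap.mem_ker.2 ?_
      change mfderiv 𝓘(ℝ, E) 𝓘(ℝ, F) p x (v - H.lift x (mfderiv 𝓘(ℝ, E) 𝓘(ℝ, F) p x v)) = 0
      rw [map_sub, H.mfderiv_lift, sub_self]

theorem coe_verProj (x : M) (v : TangentSpace 𝓘(ℝ, E) x) :
    (H.verProj x v : TangentSpace 𝓘(ℝ, E) x)
      = v - H.lift x (mfderiv 𝓘(ℝ, E) 𝓘(ℝ, F) p x v) := rfl

theorem verProj_coe (x : M) (v : Ver E F p x) : H.verProj x v = v := by
  apply Subtype.ext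
  have hv : mfderiv 𝓘(ℝ, E) 𝓘(ℝ, F) p x (v : TangentSpace 𝓘(ℝ, E) x) = 0 := v.2
  rw [coe_verProj, hv, map_zero, sub_zero]

theorem verProj_lift (x : M) (u : TangentSpace 𝓘(ℝ, F) (p x)) : H.verProj x (H.lift x u) = 0 := by
  apply Subtype.ext
  rw [coe_verProj, H.mfderiv_lift, sub_self]
  rfl

variable [FiniteDimensional ℝ E] [FiniteDimensional ℝ F] [T2Space B]

/-- The horizontal part of a vector field. -/
noncomputable def horField (hp : ContMDiff 𝓘(ℝ, E) 𝓘(ℝ, F) ∞ p) (X : VField E M) : VField E M :=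
  ⟨fun x => H.lift x (mfderiv 𝓘(ℝ, E) 𝓘(ℝ, F) p x (X x)), fun x => by
    obtain ⟨d, u, hu⟩ := exists_mfderiv_eq_sum x p hp
    obtain ⟨c, hc, hX⟩ := hu X
    have h : CMDiffAt ∞ (T% (fun z => ∑ i, c i z • H.lift z (u i (p z)))) x :=
      ContMDiffAt.sum_section fun i _ => (hc i).smul_section (H.smooth (u i) x)
    refine h.congr_of_eventuallyEq ?_
    filter_upwards [hX] with z hz
    rw [hz, map_sum]
    simp⟩

/-- The vertical part of a vector field. -/
noncomputable def verField (hp : ContMDiff 𝓘(ℝ, E) 𝓘(ℝ, F) ∞ p) (X : VField E M) :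
    VerField E F p :=
  ⟨X - H.horField hp X, fun x => (H.verProj x (X x)).2⟩

end EhresmannConnection

theorem HorTwoForm.contMDiff_apply_mfderiv [FiniteDimensional ℝ F] [T2Space B]
    (β : HorTwoForm E F p) (hp : ContMDiff 𝓘(ℝ, E) 𝓘(ℝ, F) ∞ p) (X Y : VField E M) :
    ContMDiff 𝓘(ℝ, E) 𝓘(ℝ, ℝ) ∞ (fun x => β.toFun x
      ![mfderiv 𝓘(ℝ, E) 𝓘(ℝ, F) p x (X x), mfderiv 𝓘(ℝ, E) 𝓘(ℝ, F) p x (Y x)]) := by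
  intro x
  obtain ⟨d, u, hu⟩ := exists_mfderiv_eq_sum x p hp
  obtain ⟨c, hc, hX⟩ := hu X
  obtain ⟨c', hc', hY⟩ := hu Y
  have h : ContMDiffAt 𝓘(ℝ, E) 𝓘(ℝ, ℝ) ∞ (fun z => ∑ i, ∑ j, c i z * c' j z *
      β.toFun z ![u i (p z), u j (p z)]) x :=
    ContMDiffAt.sum fun i _ => ContMDiffAt.sum fun j _ =>
      ((hc i).mul (hc' j)).mul (β.smooth (u i) (u j) x)
  refine h.congr_of_eventuallyEq ?_
  filter_upwards [hX, hY] with z hz hz'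
  rw [hz, hz', ContinuousAlternatingMap.apply_two_sum]

variable [FiniteDimensional ℝ E] [FiniteDimensional ℝ F] [T2Space M] [T2Space B]

/-- The coupling form of a connection `H` and a function-valued form `β`: it restricts to `η` on
the vertical spaces, to `-β` on the horizontal spaces, and makes the two orthogonal. The sign is the
one for which `i_C η = - d_V β` cancels the component of `dΩ` with one vertical argument. -/
noncomputable def couplingForm (hp : ContMDiff 𝓘(ℝ, E) 𝓘(ℝ, F) ∞ p) (H : EhresmannConnection E F p)
    (η : VerTwoForm E F p) (β : HorTwoForm E F p) : DiffForm E M 2 where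
  toFun x := (η.toFun x).compContinuousLinearMap (H.verProj x)
    - (β.toFun x).compContinuousLinearMap (mfderiv 𝓘(ℝ, E) 𝓘(ℝ, F) p x)
  smooth := by
    refine contDiffOn_chartExpr_of_vField _ fun X => ?_
    refine ((η.smooth (H.verField hp (X 0)) (H.verField hp (X 1))).sub
      (β.contMDiff_apply_mfderiv hp (X 0) (X 1))).congr fun x => ?_
    change η.toFun x _ - β.toFun x _ = _
    congr 2
    · ext1 i; fin_cases i <;> rfl
    · ext1 i; fin_cases i <;> rfl

section

variable (hp : ContMDiff 𝓘(ℝ, E) 𝓘(ℝ, F) ∞ p) (H : EhresmannConnection E F p)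
  (η : VerTwoForm E F p) (β : HorTwoForm E F p)

theorem couplingForm_apply (x : M) (v w : TangentSpace 𝓘(ℝ, E) x) :
    couplingForm hp H η β x ![v, w] = η.toFun x ![H.verProj x v, H.verProj x w]
      - β.toFun x ![mfderiv 𝓘(ℝ, E) 𝓘(ℝ, F) p x v, mfderiv 𝓘(ℝ, E) 𝓘(ℝ, F) p x w] := by
  change η.toFun x _ - β.toFun x _ = _
  congr 2
  · ext1 i; fin_cases i <;> rfl
  · ext1 i; fin_cases i <;> rfl

theorem couplingForm_ver_ver (x : M) (v w : Ver E F p x) :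
    couplingForm hp H η β x ![(v : TangentSpace 𝓘(ℝ, E) x), w] = η.toFun x ![v, w] := by
  have hv : mfderiv 𝓘(ℝ, E) 𝓘(ℝ, F) p x (v : TangentSpace 𝓘(ℝ, E) x) = 0 := v.2
  rw [couplingForm_apply, H.verProj_coe, H.verProj_coe, hv,
    (β.toFun x).map_coord_zero 0 rfl, sub_zero]

theorem couplingForm_lift_ver (x : M) (u : TangentSpace 𝓘(ℝ, F) (p x)) (v : Ver E F p x) :
    couplingForm hp H η β x ![H.lift x u, (v : TangentSpace 𝓘(ℝ, E) x)] = 0 := by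
  have hv : mfderiv 𝓘(ℝ, E) 𝓘(ℝ, F) p x (v : TangentSpace 𝓘(ℝ, E) x) = 0 := v.2
  rw [couplingForm_apply, H.verProj_lift, hv, (β.toFun x).map_coord_zero 1 rfl,
    (η.toFun x).map_coord_zero 0 rfl, sub_zero]

theorem couplingForm_ver_lift (x : M) (u : TangentSpace 𝓘(ℝ, F) (p x)) (v : Ver E F p x) :
    couplingForm hp H η β x ![(v : TangentSpace 𝓘(ℝ, E) x), H.lift x u] = 0 := by
  rw [ContinuousAlternatingMap.apply_two_swap, couplingForm_lift_ver, neg_zero]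

theorem couplingForm_lift_lift (x : M) (u v : TangentSpace 𝓘(ℝ, F) (p x)) :
    couplingForm hp H η β x ![H.lift x u, H.lift x v] = - β.toFun x ![u, v] := by
  rw [couplingForm_apply, H.verProj_lift, H.mfderiv_lift, H.mfderiv_lift,
    (η.toFun x).map_coord_zero 0 rfl, zero_sub]

/-- `dΩ` on three vertical vectors is `d_V η`. -/
theorem couplingForm_d_ver_ver_ver (X Y Z : VerField E F p) (x : M) :
    (couplingForm hp H η β).d x ![X.1 x, Y.1 x, Z.1 x] = η.dVer hp X Y Z x := by
  have h : ∀ (V W : VerField E F p) z,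
      couplingForm hp H η β z ![V.1 z, W.1 z] = η.eval V W z := fun V W z =>
    couplingForm_ver_ver hp H η β z (V.at' z) (W.at' z)
  have h1 := h (X.bracket hp Y) Z x
  have h2 := h (X.bracket hp Z) Y x
  have h3 := h (Y.bracket hp Z) X x
  have hd := (couplingForm hp H η β).d_apply_vField X.1 Y.1 Z.1 x
  simp only [h] at hd
  rw [hd, VerTwoForm.dVer, ← h1, ← h2, ← h3]
  rfl

/-- `dΩ` on one horizontal and two vertical vectors is the Lie derivative of `η` along the
horizontal lift. -/
theorem couplingForm_d_lift_ver_ver (u : VField F B) (X Y : VerField E F p) (x : M) :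
    (couplingForm hp H η β).d x ![H.liftField u x, X.1 x, Y.1 x] = H.lieDeriv hp η u X Y x := by
  have h : ∀ (V W : VerField E F p) z,
      couplingForm hp H η β z ![V.1 z, W.1 z] = η.eval V W z := fun V W z =>
    couplingForm_ver_ver hp H η β z (V.at' z) (W.at' z)
  have h0 : ∀ (V : VerField E F p) z,
      couplingForm hp H η β z ![H.liftField u z, V.1 z] = 0 := fun V z =>
    couplingForm_lift_ver hp H η β z _ (V.at' z)
  have h0' : couplingForm hp H η β x ![X.1.bracket Y.1 x, H.liftField u x] = 0 :=
    couplingForm_ver_lift hp H η β x _ ((X.bracket hp Y).at' x)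
  have h1 : couplingForm hp H η β x ![(H.liftField u).bracket X.1 x, Y.1 x]
    = η.eval (H.liftBracket hp u X) Y x := h (H.liftBracket hp u X) Y x
  have h2 : couplingForm hp H η β x ![(H.liftField u).bracket Y.1 x, X.1 x]
    = - η.eval X (H.liftBracket hp u Y) x :=
    (h (H.liftBracket hp u Y) X x).trans ((η.toFun x).apply_two_swap _ _)
  have hd := (couplingForm hp H η β).d_apply_vField (H.liftField u) X.1 Y.1 x
  simp only [h, h0, h0', h1, h2, VField.deriv_zero] at hd
  rw [hd, EhresmannConnection.lieDeriv]
  have : (H.liftField u).deriv (fun z => η.eval X Y z) x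
    = (H.liftField u).deriv (η.eval X Y) x := rfl
  rw [this]
  ring

/-- `dΩ` on two horizontal and one vertical vector is minus the sum of the contracted curvature
`i_C η` and the vertical differential `d_V β`. -/
theorem couplingForm_d_lift_lift_ver (u v : VField F B) (X : VerField E F p) (x : M) :
    (couplingForm hp H η β).d x ![H.liftField u x, H.liftField v x, X.1 x]
      = - (η.eval (H.curvature hp u v) X x + X.1.deriv (β.eval u v) x) := by
  have h0 : ∀ (w : VField F B) (V : VerField E F p) z,
      couplingForm hp H η β z ![H.liftField w z, V.1 z] = 0 := fun w V z =>
    couplingForm_lift_ver hp H η β z _ (V.at' z)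
  have h0' : ∀ w w' : VField F B,
      couplingForm hp H η β x ![(H.liftField w).bracket X.1 x, H.liftField w' x] = 0 :=
    fun w w' => couplingForm_ver_lift hp H η β x _ ((H.liftBracket hp w X).at' x)
  have h1 : ∀ z, couplingForm hp H η β z ![H.liftField u z, H.liftField v z]
      = - β.eval u v z := fun z => couplingForm_lift_lift hp H η β z _ _
  have h2 : couplingForm hp H η β x ![(H.liftField u).bracket (H.liftField v) x, X.1 x]
      = η.eval (H.curvature hp u v) X x := by
    have e : (H.liftField u).bracket (H.liftField v) x
        = (H.curvature hp u v).1 x + H.liftField (u.bracket v) x :=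
      (sub_add_cancel _ _).symm
    have hadd := (couplingForm hp H η β x).toMultilinearMap.cons_add
      ![X.1 x] ((H.curvature hp u v).1 x) (H.liftField (u.bracket v) x)
    rw [e]
    refine hadd.trans ?_
    have h3 := couplingForm_ver_ver hp H η β x ((H.curvature hp u v).at' x) (X.at' x)
    have h4 := h0 (u.bracket v) X x
    exact (congrArg₂ (· + ·) h3 h4).trans (add_zero _)
  have hd := (couplingForm hp H η β).d_apply_vField (H.liftField u) (H.liftField v) X.1 x
  simp only [h0, h0', h1, h2, VField.deriv_zero, VField.deriv_neg] at hd
  rw [hd]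
  have : X.1.deriv (fun z => β.eval u v z) x = X.1.deriv (β.eval u v) x := rfl
  rw [this]
  ring

end

/-- If the connection is symplectic and `β` is a Hamiltonian of its curvature, then `dΩ` vanishes
on vertical vectors. -/
theorem couplingForm_d_eq_zero_of_ver (hp : ContMDiff 𝓘(ℝ, E) 𝓘(ℝ, F) ∞ p)
    (H : EhresmannConnection E F p) {η : VerTwoForm E F p} {β : HorTwoForm E F p}
    (hη : ∀ (X Y Z : VerField E F p) (x : M), η.dVer hp X Y Z x = 0)
    (hH : H.IsSymplectic hp η)
    (hβ : ∀ (u v : VField F B) (X : VerField E F p) (x : M),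
      η.eval (H.curvature hp u v) X x = - X.1.deriv (β.eval u v) x)
    (x : M) (v : Fin 3 → TangentSpace 𝓘(ℝ, E) x)
    (hv : mfderiv 𝓘(ℝ, E) 𝓘(ℝ, F) p x (v 0) = 0) : (couplingForm hp H η β).d x v = 0 := by
  -- every tangent vector is the value of a vertical field plus the value of a lifted field
  have split : ∀ w : TangentSpace 𝓘(ℝ, E) x, ∃ (X : VerField E F p) (u : VField F B),
      w = X.1 x + H.liftField u x := by
    intro w
    obtain ⟨W, hW⟩ := VField.exists_apply_eq x w
    obtain ⟨u, hu⟩ := VField.exists_apply_eq (p x) (mfderiv 𝓘(ℝ, E) 𝓘(ℝ, F) p x w)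
    refine ⟨H.verField hp W, u, ?_⟩
    have h1 : (H.verField hp W).1 x = W x - H.lift x (mfderiv 𝓘(ℝ, E) 𝓘(ℝ, F) p x (W x)) := rfl
    have h2 : H.liftField u x = H.lift x (u (p x)) := rfl
    rw [h1, h2, hu, hW, sub_add_cancel]
  obtain ⟨X, hX⟩ : ∃ X : VerField E F p, X.1 x = v 0 := by
    obtain ⟨W, hW⟩ := VField.exists_apply_eq x (v 0)
    refine ⟨H.verField hp W, ?_⟩
    have h1 : (H.verField hp W).1 x = W x - H.lift x (mfderiv 𝓘(ℝ, E) 𝓘(ℝ, F) p x (W x)) := rfl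
    rw [h1, hW, hv, map_zero, sub_zero]
  obtain ⟨Y, u, hY⟩ := split (v 1)
  obtain ⟨Z, w, hZ⟩ := split (v 2)
  set T := (couplingForm hp H η β).d x
  have e : v = ![X.1 x, Y.1 x + H.liftField u x, Z.1 x + H.liftField w x] := by
    ext1 i; fin_cases i
    · exact hX.symm
    · exact hY
    · exact hZ
  have h1 : T ![X.1 x, Y.1 x, Z.1 x] = 0 :=
    (couplingForm_d_ver_ver_ver hp H η β X Y Z x).trans (hη X Y Z x)
  have h2 : ∀ (u : VField F B) (X Y : VerField E F p), T ![H.liftField u x, X.1 x, Y.1 x] = 0 :=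
    fun u X Y => (couplingForm_d_lift_ver_ver hp H η β u X Y x).trans (hH u X Y x)
  have h3 : ∀ (u v : VField F B) (X : VerField E F p),
      T ![H.liftField u x, H.liftField v x, X.1 x] = 0 := fun u v X => by
    refine (couplingForm_d_lift_lift_ver hp H η β u v X x).trans ?_
    rw [hβ u v X x]
    simp
  have h4 : T ![X.1 x, Y.1 x, H.liftField w x] = 0 := by
    rw [T.apply_three_swap', T.apply_three_swap, h2]; simp
  have h5 : T ![X.1 x, H.liftField u x, Z.1 x] = 0 := by
    rw [T.apply_three_swap, h2]; simp
  have h6 : T ![X.1 x, H.liftField u x, H.liftField w x] = 0 := by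
    rw [T.apply_three_swap, T.apply_three_swap', h3]; simp
  rw [e, T.apply_three_add, T.apply_three_add', T.apply_three_add', h1, h4, h5, h6]
  simp

end Coupling

/-! ### Differences of forms -/

section Sub

variable {E M : Type*} [NormedAddCommGroup E] [NormedSpace ℝ E]
  [TopologicalSpace M] [ChartedSpace E M] {k : ℕ}

/-- The difference of two forms. -/
noncomputable def DiffForm.sub (α β : DiffForm E M k) : DiffForm E M k where
  toFun x := α x - β x
  smooth x₀ := (α.smooth x₀).sub (β.smooth x₀)

theorem DiffForm.d_sub [IsManifold 𝓘(ℝ, E) ∞ M] (α β : DiffForm E M k) (x : M) :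
    (α.sub β).d x = α.d x - β.d x := by
  have hx := mem_extChartAt_target (I := 𝓘(ℝ, E)) x
  have h : extDeriv (chartExpr (α.sub β).toFun x) (extChartAt 𝓘(ℝ, E) x x)
      = extDeriv (chartExpr α.toFun x) (extChartAt 𝓘(ℝ, E) x x)
        - extDeriv (chartExpr β.toFun x) (extChartAt 𝓘(ℝ, E) x x) := by
    have h1 := fderiv_sub ((α.contDiffAt_chartExpr hx).differentiableAt (by simp))
      ((β.contDiffAt_chartExpr hx).differentiableAt (by simp))
    have h2 := congrArg (ContinuousAlternatingMap.alternatizeUncurryFinCLM ℝ E ℝ) h1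
    rw [map_sub] at h2
    exact h2
  exact congrArg (fun m => m.compContinuousLinearMap
    (mfderiv 𝓘(ℝ, E) 𝓘(ℝ, E) (extChartAt 𝓘(ℝ, E) x) x)) h

end Sub

/-! ### The extension theorem -/

theorem mainTheorem1
    {E F M B : Type*}
    [NormedAddCommGroup E] [NormedSpace ℝ E] [FiniteDimensional ℝ E]
    [NormedAddCommGroup F] [NormedSpace ℝ F] [FiniteDimensional ℝ F]
    [TopologicalSpace M] [ChartedSpace E M] [IsManifold 𝓘(ℝ, E) ∞ M]
    [T2Space M] [SecondCountableTopology M]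
    [TopologicalSpace B] [ChartedSpace F B] [IsManifold 𝓘(ℝ, F) ∞ B]
    [T2Space B] [SecondCountableTopology B]
    (p : M → B)
    (hp : Manifold.IsSubmersion 𝓘(ℝ, E) 𝓘(ℝ, F) ∞ p)
    (hfib : ∀ b : B, IsConnected (p ⁻¹' {b}))
    (ωV : VerTwoForm E F p)
    (hωV : ωV.FibrewiseSymplectic hp.contMDiff)
    (hconn : ∃ H : EhresmannConnection E F p,
      H.IsSymplectic hp.contMDiff ωV ∧ H.HasHamiltonianCurvature hp.contMDiff ωV) :
    (∃ (Ω : DiffForm E M 2) (φ : DiffForm F B 3),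
      ωV.IsExtendedBy Ω ∧ φ.Closed ∧ ∀ x, Ω.d x = φ.pullbackAt p x) ∧
    (∀ (Ω : DiffForm E M 2) (φ : DiffForm F B 3),
      ωV.IsExtendedBy Ω → φ.Closed → (∀ x, Ω.d x = φ.pullbackAt p x) → φ.Exact →
        ∃ Ω' : DiffForm E M 2, ωV.IsExtendedBy Ω' ∧ Ω'.Closed) := by
  have hpC := hp.contMDiff
  constructor
  · obtain ⟨H, hH, β, hβ⟩ := hconn
    obtain ⟨φ, hφ, hΩφ⟩ := DiffForm.exists_eq_pullback hp hfib H.mfderiv_lift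
      (couplingForm_d_eq_zero_of_ver hpC H hωV.closed hH hβ)
      (couplingForm hpC H ωV β).extD_closed
    exact ⟨couplingForm hpC H ωV β, φ, couplingForm_ver_ver hpC H ωV β, hφ, hΩφ⟩
  · intro Ω φ hext _ hd hex
    obtain ⟨ψ, hψ⟩ := hex
    refine ⟨Ω.sub (ψ.pullback p hpC), fun x v w => ?_, fun x => ?_⟩
    · -- `p^* ψ` vanishes on vertical vectors
      have h0 : ψ.pullback p hpC x ![(v : TangentSpace 𝓘(ℝ, E) x), w] = 0 :=
        (ψ (p x)).map_coord_zero 0 v.2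
      have h1 := hext x v w
      change Ω x ![(v : TangentSpace 𝓘(ℝ, E) x), w]
        - ψ.pullback p hpC x ![(v : TangentSpace 𝓘(ℝ, E) x), w] = _
      rw [h0, h1, sub_zero]
    · rw [DiffForm.d_sub, DiffForm.d_pullback, hd x, sub_eq_zero, DiffForm.pullbackAt, hψ (p x)]
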